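/- For positive integers $m,n$, equip $\mathbb{R}^{m\times n}$ with the trace inner product and the Frobenius norm $\|\cdot\|_F$. For a matrix $U$ let $\|U\|_{2,0}$ denote its number of nonzero columns. **Setting.** Let $M\in\mathbb{R}^{m\times n}$ have rank $r\ge 1$, with singular values $\sigma_1\ge\sigma_2\ge\cdots\ge\sigma_r>0$. Let $\mathcal{A}:\mathbb{R}^{m\times n}\to\mathbb{R}^p$ be linear, let $f(X)=\frac12\|\mathcal{A}(X)-\mathcal{A}(M)\|^2$, let $\nu,\mu>0$, and let $\kappa$ be a positive integer. Let $\mathcal{X}^*$ be the set of global minimizers of $X\mapsto \nu f(X)+\operatorname{rank}(X)$ over $\mathbb{R}^{m\times n}$, and let $\Omega_\kappa=\{X\in\mathbb{R}^{m\times n}:\operatorname{rank}(X)\le\kappa\}$. For $(U,V)\in\mathbb{R}^{m\times\kappa}\times\mathbb{R}^{n\times\kappa}$ put $$\Psi(U,V)=\nu f(UV^{\mathsf T})+\frac{\mu}{4}\|U^{\mathsf T}U-V^{\mathsf T}V\|_F^2+\frac12\big(\|U\|_{2,0}+\|V\|_{2,0}\big),$$ and let $\mathcal{W}^*$ be the set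 of global minimizers of $\Psi$. Let $$\alpha=\min_{\operatorname{rank}(X)\le 2r,\ \|X\|_F=1}\|\mathcal{A}(X)\|^2,\qquad \beta=\max_{\operatorname{rank}(X)\le 2r,\ \|X\|_F=1}\|\mathcal{A}(X)\|^2$$ be the $2r$-restricted smallest and largest eigenvalues of $\mathcal{A}^*\mathcal{A}$. For a real-valued function $g$ on a Euclidean space, the regular subdifferential $\widehat\partial g(x)$ is the set of $v$ with $\liminf_{x'\to x,\,x'\neq x}\frac{g(x')-g(x)-\langle v,x'-x\rangle}{\|x'-x\|}\ge 0$. The limiting subdifferential $\partial g(x)$ is the set of limits of sequences $v^k\in\widehat\partial g(x^k)$ with $x^k\to x$ and $g(x^k)\to g(x)$. Distances to the empty set are $+\infty$. **Theorem.** Suppose that $\mathcal{X}^*\cap\Omega_\kappa\neq\emptyset$, that $\alpha>\frac{4}{\nu\sigma_r^2}$, and that $$\frac{\beta}{\alpha}<\frac{128\sigma_1^2(4\sigma_1+\sigma_r)^2+\sigma_r^4}{128\sigma_1^2(4\sigma_1+\sigma_r)^2-\sigma_r^4}.$$ Let $(\overline U,\overline V)\in\mathcal{W}^*$. Then for every $(U,V)\in\mathbb{R}^{m\times\kappa}\times\mathbb{R}^{n\times\kappa}$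 with $\big(\|U-\overline U\|_F^2+\|V-\overline V\|_F^2\big)^{1/2}<\frac{\sqrt{\sigma_r}}{4}$ and $0<\Psi(U,V)-\Psi(\overline U,\overline V)<\frac12$, $$\operatorname{dist}^2\big(0,\partial\Psi(U,V)\big)\ \ge\ \gamma\,\big[\Psi(U,V)-\Psi(\overline U,\overline V)\big],$$ where $$\gamma=\min\left(\frac{\nu}{\beta}\left[\frac{(\beta+\alpha)\sigma_r^4}{128\sqrt{\sigma_1^3}\,(4\sigma_1+\sigma_r)^2}-\sqrt{\sigma_1}\,(\beta-\alpha)\right]^2,\ 2\mu\sigma_r\right).$$ Consequently $\Psi$ has the Kurdyka–Łojasiewicz property of exponent $1/2$ at every $(\overline U,\overline V)\in\mathcal{W}^*$: $\partial\Psi(\overline U,\overline V)\ne\emptyset$ and there are $c>0$, $\eta\in(0,\infty]$ and a neighborhood $\mathcal{U}$ of $(\overline U,\overline V)$ such that, with $\varphi(s)=c\sqrt s$, $\varphi'\big(\Psi(U,V)-\Psi(\overline U,\overline V)\big)\operatorname{dist}\big(0,\partial\Psi(U,V)\big)\ge 1$ for all $(U,V)\in\mathcal{U}$ with $\Psi(\overline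 U,\overline V)<\Psi(U,V)<\Psi(\overline U,\overline V)+\eta$. -/

import Mathlib

open Set Filter Topology
open scoped ENNReal NNReal RealInnerProductSpace Matrix.Norms.Frobenius

noncomputable section

/-! ### Generalized subdifferentials and the KL property, for finite-valued functions -/

section Variational

variable {E : Type*} [NormedAddCommGroup E] [InnerProductSpace ℝ E]

/-- The regular (Fréchet) subdifferential of `g` at `x`: all `v` such that
`g x' ≥ g x + ⟪v, x' - x⟫ - o(‖x' - x‖)` as `x' → x`, that is, such that the lower limit of
`(g x' - g x - ⟪v, x' - x⟫) / ‖x' - x‖` as `x' → x`, `x' ≠ x`, is nonnegative. -/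
def regularSubdifferential (g : E → ℝ) (x : E) : Set E :=
  {v | ∀ ε > 0, ∀ᶠ x' in 𝓝 x, -(ε * ‖x' - x‖) ≤ g x' - g x - ⟪v, x' - x⟫}

/-- The limiting subdifferential of `g` at `x`: limits of regular subgradients `v k` at points
`x k → x` with `g (x k) → g x`. -/
def limitingSubdifferential (g : E → ℝ) (x : E) : Set E :=
  {v | ∃ (xs : ℕ → E) (vs : ℕ → E),
    Tendsto xs atTop (𝓝 x) ∧ Tendsto (fun k => g (xs k)) atTop (𝓝 (g x)) ∧
    (∀ k, vs k ∈ regularSubdifferential g (xs k)) ∧ Tendsto vs atTop (𝓝 v)}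

/-- The Kurdyka-Łojasiewicz property of `g` at `x₀` with desingularizing function `φ`.
The distance `dist(0, ∂g(x))` is valued in `[0, ∞]`, and is `∞` if `∂g(x)` is empty. -/
structure HasKLPropertyWith (g : E → ℝ) (x₀ : E) (φ : ℝ → ℝ) : Prop where
  subdifferential_nonempty : (limitingSubdifferential g x₀).Nonempty
  exists_eta : ∃ η : EReal, 0 < η ∧
    ContinuousOn φ {s : ℝ | 0 ≤ s ∧ (s : EReal) < η} ∧
    ConcaveOn ℝ {s : ℝ | 0 ≤ s ∧ (s : EReal) < η} φ ∧
    (∀ s : ℝ, 0 ≤ s → (s : EReal) < η → 0 ≤ φ s) ∧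
    φ 0 = 0 ∧
    ContDiffOn ℝ 1 φ {s : ℝ | 0 < s ∧ (s : EReal) < η} ∧
    (∀ s : ℝ, 0 < s → (s : EReal) < η → 0 < deriv φ s) ∧
    ∃ N ∈ 𝓝 x₀, ∀ x ∈ N, g x₀ < g x → ((g x - g x₀ : ℝ) : EReal) < η →
      1 ≤ ENNReal.ofReal (deriv φ (g x - g x₀)) *
        Metric.infEDist 0 (limitingSubdifferential g x)

/-- The KL property of exponent `1/2` at `x₀`: one may take `φ s = c * √s` for some `c > 0`. -/
def HasKLPropertyHalf (g : E → ℝ) (x₀ : E) : Prop :=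
  ∃ c > 0, HasKLPropertyWith g x₀ (fun s => c * √s)

end Variational

/-! ### Matrices; the norm on matrices is the Frobenius norm -/

/-- The `i`-th largest singular value `σ_i(X)` of `X`, for `i = 1, 2, …`. -/
def sigma {m n : ℕ} (X : Matrix (Fin m) (Fin n) ℝ) (i : ℕ) : ℝ :=
  (Matrix.toEuclideanLin X).singularValues (i - 1)

/-- `Ω_k`: the matrices of rank at most `k`. -/
def rankLE (m n k : ℕ) : Set (Matrix (Fin m) (Fin n) ℝ) := {X | X.rank ≤ k}

/-- The `ℓ_{2,0}`-norm: the number of nonzero columns. -/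
def colNorm20 {m k : ℕ} (U : Matrix (Fin m) (Fin k) ℝ) : ℕ := Set.ncard {j : Fin k | U.col j ≠ 0}

/-- The `k`-restricted smallest eigenvalue of `A* A`. The infimum is a minimum: for `1 ≤ k` and
`m, n ≥ 1` the index set is nonempty and compact. -/
def restrictedMinEig {m n p : ℕ} (A : Matrix (Fin m) (Fin n) ℝ →ₗ[ℝ] EuclideanSpace ℝ (Fin p))
    (k : ℕ) : ℝ :=
  sInf ((fun X => ‖A X‖ ^ 2) '' {X | X ∈ rankLE m n k ∧ ‖X‖ = 1})

/-- The `k`-restricted largest eigenvalue of `A* A`; again the supremum is a maximum. -/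
def restrictedMaxEig {m n p : ℕ} (A : Matrix (Fin m) (Fin n) ℝ →ₗ[ℝ] EuclideanSpace ℝ (Fin p))
    (k : ℕ) : ℝ :=
  sSup ((fun X => ‖A X‖ ^ 2) '' {X | X ∈ rankLE m n k ∧ ‖X‖ = 1})

/-- The least-squares loss `f(X) = ½ ‖A(X) - b‖²`. -/
def leastSquares {m n p : ℕ} (A : Matrix (Fin m) (Fin n) ℝ →ₗ[ℝ] EuclideanSpace ℝ (Fin p))
    (b : EuclideanSpace ℝ (Fin p)) (X : Matrix (Fin m) (Fin n) ℝ) : ℝ :=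
  1 / 2 * ‖A X - b‖ ^ 2

/-- `X*`: the global minimizers of `ν f(X) + rank(X)`. -/
def rankRegSolutions {m n : ℕ} (ν : ℝ) (f : Matrix (Fin m) (Fin n) ℝ → ℝ) :
    Set (Matrix (Fin m) (Fin n) ℝ) :=
  {X | IsMinOn (fun Y => ν * f Y + (Y.rank : ℝ)) univ X}

/-! ### The factored problem -/

/-- The space of pairs `(U, V)` of an `m × κ` and an `n × κ` real matrix, as a Euclidean space:
its inner product is the sum of the two trace inner products. -/
abbrev FactorSpace (m n κ : ℕ) : Type :=
  EuclideanSpace ℝ ((Fin m × Fin κ) ⊕ (Fin n × Fin κ))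

/-- The component `U` of the pair `z = (U, V)`. -/
def FactorSpace.left {m n κ : ℕ} (z : FactorSpace m n κ) : Matrix (Fin m) (Fin κ) ℝ :=
  Matrix.of fun i j => z (Sum.inl (i, j))

/-- The component `V` of the pair `z = (U, V)`. -/
def FactorSpace.right {m n κ : ℕ} (z : FactorSpace m n κ) : Matrix (Fin n) (Fin κ) ℝ :=
  Matrix.of fun i j => z (Sum.inr (i, j))

/-- `Ψ(U,V) = ν f(U Vᵀ) + (μ/4) ‖Uᵀ U - Vᵀ V‖² + ½ (‖U‖_{2,0} + ‖V‖_{2,0})`. -/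
def factoredLoss {m n κ : ℕ} (ν μ : ℝ) (f : Matrix (Fin m) (Fin n) ℝ → ℝ)
    (z : FactorSpace m n κ) : ℝ :=
  ν * f (z.left * z.right.transpose)
    + μ / 4 * ‖z.left.transpose * z.left - z.right.transpose * z.right‖ ^ 2
    + 1 / 2 * ((colNorm20 z.left : ℝ) + (colNorm20 z.right : ℝ))

/-- `W*`: the global minimizers of `Ψ`. -/
def factoredSolutions {m n : ℕ} (κ : ℕ) (ν μ : ℝ) (f : Matrix (Fin m) (Fin n) ℝ → ℝ) :
    Set (FactorSpace m n κ) :=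
  {z | IsMinOn (factoredLoss ν μ f) univ z}

/-- The constant
`γ = min ((ν/β) [(β+α) σ_r⁴ / (128 √(σ₁³) (4σ₁+σ_r)²) - √σ₁ (β-α)]², 2 μ σ_r)`. -/
def klConstant (ν μ α β σ₁ σr : ℝ) : ℝ :=
  min (ν / β * ((β + α) * σr ^ 4 / (128 * √(σ₁ ^ 3) * (4 * σ₁ + σr) ^ 2)
    - √σ₁ * (β - α)) ^ 2) (2 * μ * σr)

end

/-! ### The Frobenius norm and the trace inner product -/

section Frobenius

variable {l m n k : Type*} [Fintype l] [Fintype m] [Fintype n] [Fintype k]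

/-! The column penalty `½(‖U‖_{2,0} + ‖V‖_{2,0})` dominates `rank (U Vᵀ)`, with equality at a
balanced factorization of `M` padded by zero columns. The lower bound on `α`, combined with a weak
Eckart-Young inequality, makes `M` the only matrix with `ν f + rank ≤ r`
(`eq_of_leastSquares_add_rank_le`). Hence every minimizer of `Ψ` is a balanced factorization of `M`
with exactly `r` nonzero columns in each factor, and the minimum is `r` (`factoredSolutions_spec`).

Let `(Ū, V̄)` be a minimizer. Balance gives `V̄ V̄ᵀ = (Mᵀ M)^{1/2}`, so on its column support `V̄`
is bounded below by `√σ_r` and above by `√σ₁`; `Ū` has the same Gram matrix and the same bounds.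
Within distance `√σ_r / 4` no nonzero column can vanish, and a gap below `1/2` leaves no room for an
extra one. The supports are therefore frozen, and the gap equals the value of the smooth part of
`Ψ`. Limiting subgradients agree with the smooth gradient along directions in the frozen support
(`inner_eq_of_mem_limitingSubdifferential`). The smooth gradient is itself such a direction, so by
Cauchy-Schwarz no subgradient is shorter.

What remains is a gradient-dominance inequality for the smooth part
(`klConstant_mul_le_gradient_sq`). With `D = U Vᵀ - M`, `G = A* A D` and `B = Uᵀ U - Vᵀ V`, the
data-fit and balancing parts of the gradient are orthogonal because `B` is symmetric. The balancing
part is controlled by the lower bounds on the factors. For the data-fit part, `D` is controlled by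
`D V` and `Uᵀ D` (`residual_error_bound`), and restricted isometry passes from these to `G V` and
`Uᵀ G`, at a cost proportional to `β - α`; the ratio hypothesis says precisely that the resulting
bracket is positive. -/

theorem frobenius_norm_sq_eq_sum (X : Matrix m n ℝ) : ‖X‖ ^ 2 = ∑ i, ∑ j, X i j ^ 2 := by
  rw [Matrix.frobenius_norm_def, ← Real.sqrt_eq_rpow, Real.sq_sqrt (by positivity)]
  simp

theorem trace_transpose_mul_eq_sum (X Y : Matrix m n ℝ) :
    (X.transpose * Y).trace = ∑ i, ∑ j, X i j * Y i j := by
  simp only [Matrix.trace, Matrix.diag, Matrix.mul_apply, Matrix.transpose_apply]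
  exact Finset.sum_comm

theorem frobenius_norm_sq_eq_trace (X : Matrix m n ℝ) :
    ‖X‖ ^ 2 = (X.transpose * X).trace := by
  rw [frobenius_norm_sq_eq_sum, trace_transpose_mul_eq_sum]
  simp only [sq]

theorem frobenius_norm_add_sq (X Y : Matrix m n ℝ) :
    ‖X + Y‖ ^ 2 = ‖X‖ ^ 2 + 2 * (X.transpose * Y).trace + ‖Y‖ ^ 2 := by
  simp only [frobenius_norm_sq_eq_sum, trace_transpose_mul_eq_sum, Finset.mul_sum,
    ← Finset.sum_add_distrib, Matrix.add_apply]
  exact Finset.sum_congr rfl fun i _ => Finset.sum_congr rfl fun j _ => by ring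

theorem trace_transpose_mul_le (X Y : Matrix m n ℝ) :
    (X.transpose * Y).trace ≤ ‖X‖ * ‖Y‖ := by
  have h : (X.transpose * Y).trace ^ 2 ≤ (‖X‖ * ‖Y‖) ^ 2 := by
    rw [mul_pow, frobenius_norm_sq_eq_sum, frobenius_norm_sq_eq_sum, trace_transpose_mul_eq_sum]
    simp only [← Fintype.sum_prod_type']
    exact Finset.sum_mul_sq_le_sq_mul_sq _ _ _
  exact le_of_sq_le_sq h (by positivity)

theorem frobenius_norm_eq_of_gram_eq {X : Matrix l n ℝ} {Y : Matrix m n ℝ}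
    (h : X.transpose * X = Y.transpose * Y) (Z : Matrix n k ℝ) : ‖X * Z‖ = ‖Y * Z‖ := by
  rw [← sq_eq_sq₀ (norm_nonneg _) (norm_nonneg _), frobenius_norm_sq_eq_trace,
    frobenius_norm_sq_eq_trace, Matrix.transpose_mul, Matrix.transpose_mul, Matrix.mul_assoc,
    ← Matrix.mul_assoc _ X, h, Matrix.mul_assoc, Matrix.mul_assoc]

theorem trace_transpose_mul_mul (X : Matrix m n ℝ) (Y : Matrix m l ℝ) (Z : Matrix l n ℝ) :
    (X.transpose * (Y * Z)).trace = ((Y.transpose * X).transpose * Z).trace := by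
  rw [Matrix.transpose_mul, Matrix.transpose_transpose, Matrix.mul_assoc]

theorem frobenius_norm_isometry_mul [DecidableEq n] {P : Matrix m n ℝ}
    (hP : P.transpose * P = 1) (X : Matrix n k ℝ) : ‖P * X‖ = ‖X‖ := by
  have := frobenius_norm_eq_of_gram_eq (X := P) (Y := (1 : Matrix n n ℝ)) (by simp [hP]) X
  simpa using this

theorem frobenius_norm_coisometry_mul_le [DecidableEq n] {P : Matrix m n ℝ}
    (hP : P.transpose * P = 1) (X : Matrix m k ℝ) : ‖P.transpose * X‖ ≤ ‖X‖ := by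
  have h : ‖P.transpose * X‖ ^ 2 ≤ ‖X‖ * ‖P.transpose * X‖ := by
    rw [frobenius_norm_sq_eq_trace, ← trace_transpose_mul_mul]
    exact (trace_transpose_mul_le _ _).trans_eq (by rw [frobenius_norm_isometry_mul hP])
  by_contra! hlt
  nlinarith [norm_nonneg X]

theorem frobenius_norm_sq_eq_add_of_projection {P : Matrix m m ℝ}
    (hPt : P.transpose = P) (hPP : P * P = P) (X : Matrix m n ℝ) :
    ‖X‖ ^ 2 = ‖P * X‖ ^ 2 + ‖X - P * X‖ ^ 2 := by
  have h := frobenius_norm_add_sq (P * X) (X - P * X)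
  rw [add_sub_cancel] at h
  rw [h]
  have : ((P * X).transpose * (X - P * X)).trace = 0 := by
    rw [Matrix.mul_sub, ← Matrix.mul_assoc _ P X, Matrix.transpose_mul, hPt, Matrix.mul_assoc _ P P,
      hPP, sub_self, Matrix.trace_zero]
  rw [this]; ring

theorem frobenius_norm_projection_mul_le {P : Matrix m m ℝ}
    (hPt : P.transpose = P) (hPP : P * P = P) (X : Matrix m n ℝ) : ‖P * X‖ ≤ ‖X‖ := by
  refine le_of_sq_le_sq ?_ (norm_nonneg _)
  rw [frobenius_norm_sq_eq_add_of_projection hPt hPP X]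
  nlinarith [sq_nonneg ‖X - P * X‖]

theorem frobenius_norm_sub_projection_mul_le {P : Matrix m m ℝ}
    (hPt : P.transpose = P) (hPP : P * P = P) (X : Matrix m n ℝ) : ‖X - P * X‖ ≤ ‖X‖ := by
  refine le_of_sq_le_sq ?_ (norm_nonneg _)
  rw [frobenius_norm_sq_eq_add_of_projection hPt hPP X]
  nlinarith [sq_nonneg ‖P * X‖]

end Frobenius

/-! ### A compact singular value decomposition -/

section SingularValues

variable {m n r : ℕ}

theorem rank_eq_finrank_range_toEuclideanLin (M : Matrix (Fin m) (Fin n) ℝ) :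
    M.rank = Module.finrank ℝ (LinearMap.range (Matrix.toEuclideanLin M)) := by
  rw [Matrix.rank_eq_finrank_range_toLin M (EuclideanSpace.basisFun _ ℝ).toBasis
    (EuclideanSpace.basisFun _ ℝ).toBasis]
  rw [show Matrix.toEuclideanLin M = _ from
    congrFun (congrArg DFunLike.coe (Matrix.toLpLin_eq_toLin 2 2)) M]
  rfl

/-- The condition `1 ≤ i` cannot be dropped: truncated subtraction makes `sigma M 0` equal to `sigma
M 1`, which is `0` for `M = 0`. -/
theorem sigma_pos {M : Matrix (Fin m) (Fin n) ℝ} {i : ℕ} (hi : 1 ≤ i) (hM : i ≤ M.rank) :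
    0 < sigma M i := by
  unfold sigma
  rw [LinearMap.singularValues_pos_iff_lt_finrank_range]
  have := rank_eq_finrank_range_toEuclideanLin M
  omega

theorem sigma_le_sigma (M : Matrix (Fin m) (Fin n) ℝ) {i j : ℕ} (hij : i ≤ j) :
    sigma M j ≤ sigma M i :=
  LinearMap.singularValues_antitone _ (Nat.sub_le_sub_right hij 1)

theorem sigma_nonneg (M : Matrix (Fin m) (Fin n) ℝ) (i : ℕ) : 0 ≤ sigma M i :=
  LinearMap.singularValues_nonneg _ _

/-- The right singular vectors of `M` for the nonzero singular values, as the columns of `P`. -/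
theorem exists_right_singular_vectors (M : Matrix (Fin m) (Fin n) ℝ) (hM : M.rank = r) :
    ∃ P : Matrix (Fin n) (Fin r) ℝ, P.transpose * P = 1 ∧ M * P * P.transpose = M ∧
      (M * P).transpose * (M * P) = Matrix.diagonal fun i : Fin r => sigma M (i + 1) ^ 2 := by
  set T := Matrix.toEuclideanLin M with hT
  have hn : Module.finrank ℝ (EuclideanSpace ℝ (Fin n)) = n := finrank_euclideanSpace_fin
  set b := T.isSymmetric_adjoint_comp_self.eigenvectorBasis hn with hb
  have hrn : r ≤ n := by
    have := M.rank_le_width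
    omega
  set Q : Matrix (Fin n) (Fin n) ℝ := Matrix.of fun i j => b j i with hQ
  have hQQ : Q.transpose * Q = 1 := by
    ext i j
    have := orthonormal_iff_ite.1 b.orthonormal j i
    rw [PiLp.inner_apply] at this
    simp only [Matrix.mul_apply, Matrix.transpose_apply, hQ, Matrix.of_apply, Matrix.one_apply]
    simpa [eq_comm] using this
  have hgram : (M * Q).transpose * (M * Q) = Matrix.diagonal fun i : Fin n => sigma M (i + 1) ^ 2 := by
    ext i j
    have h1 : ((M * Q).transpose * (M * Q)) i j = ⟪T (b j), T (b i)⟫ := by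
      rw [PiLp.inner_apply]
      simp [Matrix.mul_apply, Matrix.toLpLin_apply, Matrix.mulVec, dotProduct, hQ, hT]
      exact Finset.sum_congr rfl fun k _ =>
        congrArg (· * _) (Finset.sum_congr rfl fun l _ => mul_comm _ _)
    rw [h1, ← LinearMap.adjoint_inner_right, ← LinearMap.comp_apply,
      LinearMap.IsSymmetric.apply_eigenvectorBasis, inner_smul_right,
      orthonormal_iff_ite.1 b.orthonormal j i, ← LinearMap.sq_singularValues_fin]
    simp only [Matrix.diagonal_apply, sigma, Nat.add_sub_cancel]
    by_cases hij : i = j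
    · simp [hij, hT]
    · simp [hij, Ne.symm hij]
  -- The squared length of column `j` of `M * Q` is a vanishing singular value squared, so
  -- truncating `Q` to its first `r` columns loses nothing.
  have hzero : ∀ j : Fin n, r ≤ j → ∀ i, (M * Q) i j = 0 := by
    intro j hj i
    have h1 : ((M * Q).transpose * (M * Q)) j j = 0 := by
      have hrk := rank_eq_finrank_range_toEuclideanLin M
      have : sigma M (j + 1) = 0 := by
        unfold sigma
        rw [LinearMap.singularValues_eq_zero_iff_le_finrank_range]
        omega
      rw [hgram]
      simp [this]
    rw [Matrix.mul_apply] at h1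
    simp only [Matrix.transpose_apply] at h1
    have := (Finset.sum_eq_zero_iff_of_nonneg (fun k _ => mul_self_nonneg _)).1 h1 i
      (Finset.mem_univ _)
    exact mul_self_eq_zero.1 this
  refine ⟨Q.submatrix id (Fin.castLE hrn), ?_, ?_, ?_⟩
  · ext i j
    have := congrFun (congrFun hQQ (Fin.castLE hrn i)) (Fin.castLE hrn j)
    simpa [Matrix.mul_apply, Matrix.one_apply] using this
  · have hMQ : M * Q.submatrix id (Fin.castLE hrn) = (M * Q).submatrix id (Fin.castLE hrn) := by
      ext i j
      simp [Matrix.mul_apply]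
    have hM' : M = M * Q * Q.transpose := by
      rw [Matrix.mul_assoc, mul_eq_one_comm.1 hQQ, Matrix.mul_one]
    rw [hMQ]
    conv_rhs => rw [hM']
    ext i j
    simp only [Matrix.mul_apply (M := M * Q) (N := Q.transpose)]
    rw [Matrix.mul_apply]
    simp only [Matrix.submatrix_apply, Matrix.transpose_apply, id]
    refine Fintype.sum_of_injective (Fin.castLE hrn) (Fin.castLE_injective hrn) _ _ ?_ ?_
    · intro k hk
      rw [hzero k _ i, zero_mul]
      by_contra! hlt
      exact hk ⟨⟨k, hlt⟩, rfl⟩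
    · intro k; rfl
  · ext i j
    have := congrFun (congrFun hgram (Fin.castLE hrn i)) (Fin.castLE hrn j)
    simpa [Matrix.mul_apply, Matrix.diagonal_apply] using this

/-- The orthogonal projection onto the column space of a matrix. -/
theorem exists_column_projection (V : Matrix (Fin n) (Fin m) ℝ) :
    ∃ (P : Matrix (Fin n) (Fin n) ℝ) (W : Matrix (Fin m) (Fin n) ℝ),
      P.transpose = P ∧ P * P = P ∧ P * V = V ∧ P = V * W ∧ P.trace = V.rank := by
  obtain ⟨Q, hQ, hVQ, hd⟩ := exists_right_singular_vectors V.transpose rfl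
  have hPV : Q * Q.transpose * V = V := by
    have := congrArg Matrix.transpose hVQ
    simpa [Matrix.mul_assoc] using this
  set d : Fin V.transpose.rank → ℝ := fun i => sigma V.transpose (i + 1) ^ 2 with hdd
  have hdi : Matrix.diagonal d * Matrix.diagonal (fun i => (d i)⁻¹) = 1 := by
    rw [Matrix.diagonal_mul_diagonal]
    convert Matrix.diagonal_one using 2
    ext i
    exact mul_inv_cancel₀ (pow_pos (sigma_pos (by omega) (by omega)) 2).ne'
  -- Since `Q Qᵀ V = V`, one has `Q diag(d) = V Vᵀ Q`; dividing by the positive `d` writes the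
  -- columns of `Q` as combinations of those of `V`.
  have hQV : Q = V * (V.transpose * Q * Matrix.diagonal fun i => (d i)⁻¹) := by
    calc Q = Q * (Matrix.diagonal d * Matrix.diagonal (fun i => (d i)⁻¹)) := by
          rw [hdi, Matrix.mul_one]
      _ = Q * Q.transpose * V * V.transpose * Q * Matrix.diagonal (fun i => (d i)⁻¹) := by
          rw [← hd]; simp only [Matrix.transpose_mul, Matrix.transpose_transpose, Matrix.mul_assoc]
      _ = _ := by rw [hPV]; simp only [Matrix.mul_assoc]
  refine ⟨Q * Q.transpose, (V.transpose * Q * Matrix.diagonal fun i => (d i)⁻¹) * Q.transpose,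
    ?_, ?_, hPV, ?_, ?_⟩
  · simp
  · rw [Matrix.mul_assoc, ← Matrix.mul_assoc Q.transpose, hQ, Matrix.one_mul]
  · rw [← Matrix.mul_assoc, ← hQV]
  · rw [Matrix.trace_mul_comm, hQ, Matrix.trace_one, Fintype.card_fin, Matrix.rank_transpose]

end SingularValues

/-! ### Norm bounds by extreme singular values; distance to low-rank matrices -/

section SingularValueBounds

variable {m n r : ℕ}

theorem frobenius_norm_sq_mul_eq_sum_of_gram_diagonal {k : Type*} [Fintype k]
    {N : Matrix (Fin m) (Fin r) ℝ} {d : Fin r → ℝ}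
    (hN : N.transpose * N = Matrix.diagonal d) (Z : Matrix (Fin r) k ℝ) :
    ‖N * Z‖ ^ 2 = ∑ i, ∑ j, d i * Z i j ^ 2 := by
  rw [frobenius_norm_sq_eq_trace, Matrix.transpose_mul, Matrix.mul_assoc, ← Matrix.mul_assoc _ N, hN,
    trace_transpose_mul_eq_sum]
  refine Finset.sum_congr rfl fun i _ => Finset.sum_congr rfl fun j _ => ?_
  rw [Matrix.diagonal_mul]
  ring

theorem frobenius_norm_mul_le_sigma_one {k : Type*} [Fintype k] (M : Matrix (Fin m) (Fin n) ℝ)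
    (Y : Matrix (Fin n) k ℝ) : ‖M * Y‖ ≤ sigma M 1 * ‖Y‖ := by
  obtain ⟨P, hP, hMP, hd⟩ := exists_right_singular_vectors M rfl
  have h1 : ‖M * Y‖ = ‖M * P * (P.transpose * Y)‖ := by rw [← Matrix.mul_assoc, hMP]
  refine le_of_sq_le_sq ?_ (mul_nonneg (sigma_nonneg _ _) (norm_nonneg _))
  calc ‖M * Y‖ ^ 2 = ∑ i : Fin M.rank, ∑ j, sigma M (i + 1) ^ 2 * (P.transpose * Y) i j ^ 2 := by
        rw [h1, frobenius_norm_sq_mul_eq_sum_of_gram_diagonal hd]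
    _ ≤ ∑ i : Fin M.rank, ∑ j, sigma M 1 ^ 2 * (P.transpose * Y) i j ^ 2 := by
        gcongr with i _ j _
        · exact sigma_nonneg _ _
        · exact sigma_le_sigma M (by omega)
    _ = (sigma M 1 * ‖P.transpose * Y‖) ^ 2 := by
        rw [mul_pow, frobenius_norm_sq_eq_sum]
        simp only [Finset.mul_sum]
    _ ≤ (sigma M 1 * ‖Y‖) ^ 2 := by
        gcongr
        · exact mul_nonneg (sigma_nonneg _ _) (norm_nonneg _)
        · exact sigma_nonneg _ _
        · exact frobenius_norm_coisometry_mul_le hP Y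

theorem sigma_rank_mul_frobenius_norm_le {k : Type*} [Fintype k] {M : Matrix (Fin m) (Fin n) ℝ}
    {P : Matrix (Fin n) (Fin r) ℝ}
    (hd : (M * P).transpose * (M * P) = Matrix.diagonal fun i : Fin r => sigma M (i + 1) ^ 2)
    (Z : Matrix (Fin r) k ℝ) : sigma M r * ‖Z‖ ≤ ‖M * P * Z‖ := by
  refine le_of_sq_le_sq ?_ (norm_nonneg _)
  rw [frobenius_norm_sq_mul_eq_sum_of_gram_diagonal hd, mul_pow, frobenius_norm_sq_eq_sum]
  simp only [Finset.mul_sum]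
  gcongr with i _ j _
  · exact sigma_nonneg _ _
  · exact sigma_le_sigma M (by omega)

/-- `Y'` is the projection of `Y` onto the row space of `M`, where `M` is bounded below by its least
nonzero singular value. -/
theorem exists_mul_eq_and_sigma_rank_mul_norm_le {k : Type*} [Fintype k]
    {M : Matrix (Fin m) (Fin n) ℝ} (hM : M.rank = r) (Y : Matrix (Fin n) k ℝ) :
    ∃ Y' : Matrix (Fin n) k ℝ, M * Y' = M * Y ∧ sigma M r * ‖Y'‖ ≤ ‖M * Y‖ := by
  obtain ⟨P, hP, hMP, hd⟩ := exists_right_singular_vectors M hM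
  have h1 : M * (P * (P.transpose * Y)) = M * Y := by
    rw [← Matrix.mul_assoc, ← Matrix.mul_assoc, hMP]
  refine ⟨P * (P.transpose * Y), h1, ?_⟩
  rw [← h1, frobenius_norm_isometry_mul hP, ← Matrix.mul_assoc]
  exact sigma_rank_mul_frobenius_norm_le hd _

/-- A weak form of the Eckart-Young-Mirsky theorem. -/
theorem rank_sub_rank_mul_sigma_sq_le {M : Matrix (Fin m) (Fin n) ℝ} (hM : M.rank = r)
    (X : Matrix (Fin m) (Fin n) ℝ) :
    ((r : ℝ) - X.rank) * sigma M r ^ 2 ≤ ‖X - M‖ ^ 2 := by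
  obtain ⟨P, hP, hMP, hd⟩ := exists_right_singular_vectors M hM
  obtain ⟨Q, hQ, hXQ, -⟩ := exists_right_singular_vectors (X * P) rfl
  -- In coordinates of the row space of `M`, `R` projects onto the kernel of `X`, of dimension at
  -- least `r - rank X`; there `X - M` acts as `-M`, which is bounded below by `σ_r`.
  set R : Matrix (Fin r) (Fin r) ℝ := 1 - Q * Q.transpose with hR
  have hRt : R.transpose = R := by simp [hR]
  have hRR : R * R = R := by
    have : Q * Q.transpose * (Q * Q.transpose) = Q * Q.transpose := by
      rw [Matrix.mul_assoc, ← Matrix.mul_assoc Q.transpose, hQ, Matrix.one_mul]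
    rw [hR, Matrix.sub_mul, Matrix.one_mul, Matrix.mul_sub, this, Matrix.mul_one, sub_self, sub_zero]
  have hXR : X * P * R = 0 := by
    rw [hR, Matrix.mul_sub, ← Matrix.mul_assoc, hXQ]
    simp
  have hRn : ‖R‖ ^ 2 = r - (X * P).rank := by
    rw [frobenius_norm_sq_eq_trace, hRt, hRR, hR, Matrix.trace_sub, Matrix.trace_mul_comm, hQ]
    simp
  have h1 : ‖M * P * R‖ ≤ ‖X - M‖ := by
    have h0 : (R * ((X - M) * P).transpose).transpose = -(M * P * R) := by
      rw [Matrix.transpose_mul, Matrix.transpose_transpose, hRt, Matrix.sub_mul, Matrix.sub_mul,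
        hXR, zero_sub]
    calc ‖M * P * R‖ = ‖R * ((X - M) * P).transpose‖ := by
          rw [← Matrix.frobenius_norm_transpose (R * _), h0, norm_neg]
      _ ≤ ‖((X - M) * P).transpose‖ := frobenius_norm_projection_mul_le hRt hRR _
      _ ≤ ‖(X - M).transpose‖ := by
          rw [Matrix.transpose_mul]
          exact frobenius_norm_coisometry_mul_le hP _
      _ = ‖X - M‖ := Matrix.frobenius_norm_transpose _
  have h2 := sigma_rank_mul_frobenius_norm_le hd R
  have h3 : ((X * P).rank : ℝ) ≤ X.rank := by exact_mod_cast Matrix.rank_mul_le_left X P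
  calc ((r : ℝ) - X.rank) * sigma M r ^ 2 ≤ ‖R‖ ^ 2 * sigma M r ^ 2 := by
        rw [hRn]; gcongr
    _ = (sigma M r * ‖R‖) ^ 2 := by ring
    _ ≤ ‖X - M‖ ^ 2 := by
        have := sigma_nonneg M r
        gcongr
        exact h2.trans h1

end SingularValueBounds

/-! ### Nonzero columns, rank and balanced factorizations -/

section ColumnSupport

variable {m n k : ℕ}

theorem rank_le_colNorm20 (U : Matrix (Fin m) (Fin k) ℝ) : U.rank ≤ colNorm20 U := by
  classical
  rw [Matrix.rank_eq_finrank_span_cols, colNorm20]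
  have hspan : Submodule.span ℝ (Set.range U.col) =
      Submodule.span ℝ (U.col '' {j | U.col j ≠ 0}) := by
    apply le_antisymm
    · rw [Submodule.span_le]
      rintro _ ⟨j, rfl⟩
      by_cases hj : U.col j = 0
      · rw [hj]; exact Submodule.zero_mem _
      · exact Submodule.subset_span ⟨j, hj, rfl⟩
    · exact Submodule.span_mono (Set.image_subset_range _ _)
  rw [hspan, ← Set.coe_toFinset {j | U.col j ≠ 0}, ← Finset.coe_image, Set.ncard_coe_finset]
  exact (finrank_span_finset_le_card _).trans Finset.card_image_le

theorem colNorm20_le_of_forall_col_eq_zero {U : Matrix (Fin m) (Fin k) ℝ} {r : ℕ}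
    (h : ∀ j : Fin k, r ≤ j → U.col j = 0) : colNorm20 U ≤ r := by
  have h1 : (Set.Iio r).ncard = r := by
    rw [← Finset.coe_Iio, Set.ncard_coe_finset, Nat.card_Iio]
  rw [colNorm20, ← Set.ncard_image_of_injective _ Fin.val_injective]
  conv_rhs => rw [← h1]
  refine Set.ncard_le_ncard ?_ (Set.finite_Iio r)
  rintro _ ⟨j, hj, rfl⟩
  by_contra! hle
  exact hj (h j (not_lt.1 hle))

/-- Split the singular values evenly, giving each factor `√σ_i`, and pad with zero columns by means
of `E`. -/
theorem exists_balanced_factorization {r : ℕ} {M : Matrix (Fin m) (Fin n) ℝ} (hM : M.rank = r)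
    (hrk : r ≤ k) :
    ∃ (U : Matrix (Fin m) (Fin k) ℝ) (V : Matrix (Fin n) (Fin k) ℝ), U * V.transpose = M ∧
      U.transpose * U = V.transpose * V ∧ colNorm20 U ≤ r ∧ colNorm20 V ≤ r := by
  obtain ⟨P, hP, hMP, hd⟩ := exists_right_singular_vectors M hM
  set s : Fin r → ℝ := fun i => √(sigma M (i + 1)) with hs
  have hspos : ∀ i : Fin r, 0 < s i := fun i => Real.sqrt_pos.2 (sigma_pos (by omega) (by omega))
  have hs4 : ∀ i : Fin r, sigma M (i + 1) ^ 2 = s i ^ 4 := fun i => by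
    rw [hs, show (4 : ℕ) = 2 * 2 by norm_num, pow_mul, Real.sq_sqrt (sigma_nonneg _ _)]
  set E : Matrix (Fin r) (Fin k) ℝ := Matrix.of fun i j => if Fin.castLE hrk i = j then 1 else 0
    with hE
  have hEE : E * E.transpose = 1 := by
    ext i j
    simp [hE, Matrix.mul_apply, Matrix.one_apply, eq_comm]
  have hcol : ∀ {l : ℕ} (N : Matrix (Fin l) (Fin r) ℝ), colNorm20 (N * E) ≤ r := by
    intro l N
    refine colNorm20_le_of_forall_col_eq_zero fun j hj => ?_
    ext i
    simp only [Matrix.col_apply, Matrix.mul_apply, hE, Matrix.of_apply, Pi.zero_apply]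
    refine Finset.sum_eq_zero fun x _ => ?_
    rw [if_neg, mul_zero]
    rintro rfl
    simp at hj
    omega
  have hsi : Matrix.diagonal (fun i => (s i)⁻¹) * Matrix.diagonal s = 1 := by
    rw [Matrix.diagonal_mul_diagonal, ← Matrix.diagonal_one]
    congr 1
    ext i
    exact inv_mul_cancel₀ (hspos i).ne'
  refine ⟨M * P * Matrix.diagonal (fun i => (s i)⁻¹) * E, P * Matrix.diagonal s * E,
    ?_, ?_, hcol _, hcol _⟩
  · calc _ = M * P * (Matrix.diagonal (fun i => (s i)⁻¹) * (E * E.transpose) * Matrix.diagonal s)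
          * P.transpose := by
          simp only [Matrix.transpose_mul, Matrix.diagonal_transpose, Matrix.mul_assoc]
      _ = M := by rw [hEE, Matrix.mul_one, hsi, Matrix.mul_one, hMP]
  · calc _ = E.transpose * (Matrix.diagonal (fun i => (s i)⁻¹) * ((M * P).transpose * (M * P)) *
          Matrix.diagonal (fun i => (s i)⁻¹)) * E := by
          simp only [Matrix.transpose_mul, Matrix.diagonal_transpose, Matrix.mul_assoc]
      _ = E.transpose * (Matrix.diagonal s * (P.transpose * P) * Matrix.diagonal s) * E := by
          rw [hd, hP, Matrix.mul_one, Matrix.diagonal_mul_diagonal, Matrix.diagonal_mul_diagonal,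
            Matrix.diagonal_mul_diagonal]
          congr 3
          ext i
          have := (hspos i).ne'
          rw [hs4]
          field_simp
      _ = _ := by
          simp only [Matrix.transpose_mul, Matrix.diagonal_transpose, Matrix.mul_assoc]

/-- When the nonzero columns of `V` are independent, the row space of `V` is the whole coordinate
subspace of its column support. -/
theorem exists_eq_transpose_mul_of_rank_eq_colNorm20 {l : Type*} {V : Matrix (Fin n) (Fin k) ℝ}
    (hV : V.rank = colNorm20 V) {X : Matrix (Fin k) l ℝ}
    (hX : ∀ j, V.col j = 0 → ∀ i, X j i = 0) : ∃ B : Matrix (Fin n) l ℝ, X = V.transpose * B := by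
  classical
  obtain ⟨P, W, hPt, hPP, hPV, hPW, htr⟩ := exists_column_projection V.transpose
  set d : Fin k → ℝ := fun j => if V.col j = 0 then 0 else 1 with hd
  have hdV : Matrix.diagonal d * V.transpose = V.transpose := by
    ext j i
    rw [Matrix.diagonal_mul, Matrix.transpose_apply]
    by_cases hj : V.col j = 0
    · have := congrFun hj i
      rw [Matrix.col_apply, Pi.zero_apply] at this
      rw [this, mul_zero]
    · simp [hd, hj]
  have hdX : Matrix.diagonal d * X = X := by
    ext j i
    rw [Matrix.diagonal_mul]
    by_cases hj : V.col j = 0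
    · rw [hX j hj i, mul_zero]
    · simp [hd, hj]
  have hdP : Matrix.diagonal d * P = P := by rw [hPW, ← Matrix.mul_assoc, hdV]
  have hPd : P * Matrix.diagonal d = P := by
    have := congrArg Matrix.transpose hdP
    rwa [Matrix.transpose_mul, hPt, Matrix.diagonal_transpose] at this
  have hdd : Matrix.diagonal d * Matrix.diagonal d = Matrix.diagonal d := by
    rw [Matrix.diagonal_mul_diagonal]
    congr 1
    ext j
    simp [hd]
  have htrd : (Matrix.diagonal d).trace = colNorm20 V := by
    rw [Matrix.trace_diagonal, colNorm20, Set.ncard_eq_toFinset_card']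
    simp [hd, Finset.sum_ite]
  -- Two nested orthogonal projections of equal trace coincide: the squared norm of their difference
  -- is the difference of the traces.
  have h0 : ‖Matrix.diagonal d - P‖ ^ 2 = 0 := by
    rw [frobenius_norm_sq_eq_trace, Matrix.transpose_sub, hPt, Matrix.diagonal_transpose,
      Matrix.sub_mul, Matrix.mul_sub, Matrix.mul_sub, hdd, hdP, hPd, hPP, sub_self, sub_zero,
      Matrix.trace_sub, htrd, htr, Matrix.rank_transpose, hV, sub_self]
  have h1 : Matrix.diagonal d = P := sub_eq_zero.1 (norm_eq_zero.1 (pow_eq_zero_iff two_ne_zero |>.1 h0))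
  exact ⟨W * X, by rw [← Matrix.mul_assoc, ← hPW, ← h1, hdX]⟩

end ColumnSupport

/-! ### Restricted eigenvalues and restricted isometry -/

section RestrictedEigenvalues

variable {m n p : ℕ} (A : Matrix (Fin m) (Fin n) ℝ →ₗ[ℝ] EuclideanSpace ℝ (Fin p)) {k : ℕ}

theorem rank_smul_le (c : ℝ) (X : Matrix (Fin m) (Fin n) ℝ) : (c • X).rank ≤ X.rank := by
  rw [← Matrix.one_mul X, ← Matrix.smul_mul, Matrix.one_mul X]
  exact Matrix.rank_mul_le_right _ _

theorem map_eq_sum_single {F : Type*} [AddCommGroup F] [Module ℝ F]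
    (B : Matrix (Fin m) (Fin n) ℝ →ₗ[ℝ] F) (X : Matrix (Fin m) (Fin n) ℝ) :
    B X = ∑ i, ∑ j, X i j • B (Matrix.single i j 1) := by
  conv_lhs => rw [Matrix.matrix_eq_sum_single X]
  simp only [map_sum]
  refine Finset.sum_congr rfl fun i _ => Finset.sum_congr rfl fun j _ => ?_
  rw [← map_smul, Matrix.smul_single, smul_eq_mul, mul_one]

theorem abs_apply_le_frobenius_norm (X : Matrix (Fin m) (Fin n) ℝ) (i : Fin m) (j : Fin n) :
    |X i j| ≤ ‖X‖ := by
  refine abs_le_of_sq_le_sq ?_ (norm_nonneg _)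
  rw [frobenius_norm_sq_eq_sum]
  exact (Finset.single_le_sum (f := fun j => X i j ^ 2) (fun _ _ => sq_nonneg _)
    (Finset.mem_univ j)).trans (Finset.single_le_sum (f := fun i => ∑ j, X i j ^ 2)
      (fun _ _ => Finset.sum_nonneg fun _ _ => sq_nonneg _) (Finset.mem_univ i))

theorem restrictedMinEig_mul_le {X : Matrix (Fin m) (Fin n) ℝ} (hX : X.rank ≤ k) :
    restrictedMinEig A k * ‖X‖ ^ 2 ≤ ‖A X‖ ^ 2 := by
  rcases eq_or_ne X 0 with rfl | h0
  · simp
  have hn : 0 < ‖X‖ := norm_pos_iff.2 h0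
  have h1 : restrictedMinEig A k ≤ ‖A (‖X‖⁻¹ • X)‖ ^ 2 := by
    refine csInf_le ⟨0, ?_⟩ ⟨‖X‖⁻¹ • X, ⟨?_, ?_⟩, rfl⟩
    · rintro _ ⟨Y, -, rfl⟩; positivity
    · exact (rank_smul_le _ _).trans hX
    · rw [norm_smul, norm_inv, norm_norm, inv_mul_cancel₀ hn.ne']
  rw [map_smul, norm_smul, norm_inv, norm_norm, mul_pow, inv_pow] at h1
  rwa [← div_eq_inv_mul, le_div_iff₀ (by positivity)] at h1

theorem le_restrictedMaxEig_mul {X : Matrix (Fin m) (Fin n) ℝ} (hX : X.rank ≤ k) :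
    ‖A X‖ ^ 2 ≤ restrictedMaxEig A k * ‖X‖ ^ 2 := by
  rcases eq_or_ne X 0 with rfl | h0
  · simp
  have hn : 0 < ‖X‖ := norm_pos_iff.2 h0
  have h1 : ‖A (‖X‖⁻¹ • X)‖ ^ 2 ≤ restrictedMaxEig A k := by
    -- An upper bound must be supplied for `sSup` to be meaningful: entries of a matrix of norm one
    -- have absolute value at most one.
    refine le_csSup ⟨(∑ i, ∑ j, ‖A (Matrix.single i j 1)‖) ^ 2, ?_⟩ ⟨‖X‖⁻¹ • X, ⟨?_, ?_⟩, rfl⟩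
    · rintro _ ⟨Y, ⟨-, hY⟩, rfl⟩
      dsimp only
      gcongr
      rw [map_eq_sum_single]
      refine (norm_sum_le _ _).trans (Finset.sum_le_sum fun i _ =>
        (norm_sum_le _ _).trans (Finset.sum_le_sum fun j _ => ?_))
      rw [norm_smul]
      refine mul_le_of_le_one_left (norm_nonneg _) ?_
      exact (abs_apply_le_frobenius_norm Y i j).trans_eq hY
    · exact (rank_smul_le _ _).trans hX
    · rw [norm_smul, norm_inv, norm_norm, inv_mul_cancel₀ hn.ne']
  rw [map_smul, norm_smul, norm_inv, norm_norm, mul_pow, inv_pow] at h1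
  rwa [← div_eq_inv_mul, div_le_iff₀ (by positivity)] at h1

/-- The restricted isometry estimate for inner products. -/
theorem restricted_inner_ge {X H : Matrix (Fin m) (Fin n) ℝ}
    (hXH : ∀ s t : ℝ, (s • X + t • H).rank ≤ k) :
    (restrictedMinEig A k + restrictedMaxEig A k) / 2 * (X.transpose * H).trace
      - (restrictedMaxEig A k - restrictedMinEig A k) / 2 * (‖X‖ * ‖H‖) ≤ ⟪A X, A H⟫ := by
  rcases eq_or_ne X 0 with rfl | hX0
  · simp
  rcases eq_or_ne H 0 with rfl | hH0
  · simp
  have hx : 0 < ‖X‖ := norm_pos_iff.2 hX0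
  have hh : 0 < ‖H‖ := norm_pos_iff.2 hH0
  set x := ‖X‖ with hxdef
  set h := ‖H‖ with hhdef
  -- Polarization: rescaling by the opposite norms gives `h X` and `x H` equal length, and the lower
  -- bound at their sum is compared with the upper bound at their difference.
  have h1 := restrictedMinEig_mul_le A (hXH h x)
  have h2 := le_restrictedMaxEig_mul A (hXH h (-x))
  rw [frobenius_norm_add_sq, map_add, map_smul, map_smul, norm_add_sq_real] at h1 h2
  simp only [norm_smul, Matrix.transpose_smul, Matrix.smul_mul, Matrix.mul_smul, Matrix.trace_smul,
    smul_eq_mul, real_inner_smul_left, real_inner_smul_right, norm_neg, ← hxdef, ← hhdef] at h1 h2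
  rw [Real.norm_of_nonneg hh.le, Real.norm_of_nonneg hx.le] at h1 h2
  have hpos : 0 < 4 * (h * x) := by positivity
  refine le_of_mul_le_mul_left ?_ hpos
  nlinarith

end RestrictedEigenvalues

/-! ### Extreme singular values of balanced factors -/

section BalancedFactorization

variable {m n k q : ℕ} {U : Matrix (Fin m) (Fin k) ℝ} {V : Matrix (Fin n) (Fin k) ℝ}

theorem norm_mul_eq_of_balanced (h : U.transpose * U = V.transpose * V)
    (Y : Matrix (Fin n) (Fin q) ℝ) :
    ‖U * V.transpose * Y‖ = ‖V * (V.transpose * Y)‖ := by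
  rw [Matrix.mul_assoc, frobenius_norm_eq_of_gram_eq h]

/-- By balance `V Vᵀ` and `U Vᵀ` stretch every matrix equally, so `V Vᵀ` has norm at most `σ₁` and
`V` at most `√σ₁`. -/
theorem norm_mul_le_of_balanced (h : U.transpose * U = V.transpose * V)
    (X : Matrix (Fin k) (Fin q) ℝ) : ‖V * X‖ ≤ √(sigma (U * V.transpose) 1) * ‖X‖ := by
  set σ := sigma (U * V.transpose) 1
  have hσ : 0 ≤ σ := sigma_nonneg _ _
  have h1 : ‖V.transpose * (V * X)‖ ≤ √σ * ‖V * X‖ := by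
    refine le_of_sq_le_sq ?_ (by positivity)
    calc ‖V.transpose * (V * X)‖ ^ 2
        = ((V * X).transpose * (V * (V.transpose * (V * X)))).trace := by
          rw [frobenius_norm_sq_eq_trace, ← trace_transpose_mul_mul]
      _ ≤ ‖V * X‖ * ‖U * V.transpose * (V * X)‖ := by
          rw [norm_mul_eq_of_balanced h]
          exact trace_transpose_mul_le _ _
      _ ≤ ‖V * X‖ * (σ * ‖V * X‖) := by
          gcongr
          exact frobenius_norm_mul_le_sigma_one _ _
      _ = (√σ * ‖V * X‖) ^ 2 := by rw [mul_pow, Real.sq_sqrt hσ]; ring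
  have h2 : ‖V * X‖ ^ 2 ≤ ‖X‖ * (√σ * ‖V * X‖) := by
    calc ‖V * X‖ ^ 2 = (X.transpose * (V.transpose * (V * X))).trace := by
          rw [frobenius_norm_sq_eq_trace, Matrix.transpose_mul, Matrix.mul_assoc]
      _ ≤ ‖X‖ * ‖V.transpose * (V * X)‖ := trace_transpose_mul_le _ _
      _ ≤ _ := by gcongr
  by_contra! hlt
  have : 0 ≤ √σ * ‖X‖ := by positivity
  nlinarith

/-- Write `X = Vᵀ B` with `B` in the row space of `U Vᵀ`. Then `σ_r ‖B‖ ≤ ‖U Vᵀ B‖ = ‖V X‖`, while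
`‖X‖² = ⟨B, V X⟩ ≤ ‖B‖ ‖V X‖`. -/
theorem le_norm_mul_of_balanced (h : U.transpose * U = V.transpose * V) {r : ℕ}
    (hrk : (U * V.transpose).rank = r) (hr : 1 ≤ r) (hV : colNorm20 V = r)
    {X : Matrix (Fin k) (Fin q) ℝ} (hX : ∀ j, V.col j = 0 → ∀ i, X j i = 0) :
    √(sigma (U * V.transpose) r) * ‖X‖ ≤ ‖V * X‖ := by
  have hσ : 0 < sigma (U * V.transpose) r := sigma_pos hr hrk.ge
  have hVr : V.rank = colNorm20 V := by
    refine le_antisymm (rank_le_colNorm20 V) ?_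
    rw [hV, ← hrk, ← Matrix.rank_transpose V]
    exact Matrix.rank_mul_le_right _ _
  obtain ⟨B₀, hB₀⟩ := exists_eq_transpose_mul_of_rank_eq_colNorm20 hVr hX
  obtain ⟨B, hMB, hB⟩ := exists_mul_eq_and_sigma_rank_mul_norm_le hrk B₀
  set σ := sigma (U * V.transpose) r
  have hXB : X = V.transpose * B := by
    have h0 : V * (V.transpose * (B - B₀)) = 0 := by
      rw [← norm_eq_zero, ← norm_mul_eq_of_balanced h, Matrix.mul_sub, hMB, sub_self, norm_zero]
    have h1 : ‖V.transpose * (B - B₀)‖ ^ 2 = 0 := by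
      rw [frobenius_norm_sq_eq_trace, ← trace_transpose_mul_mul, h0, Matrix.mul_zero,
        Matrix.trace_zero]
    have h2 := norm_eq_zero.1 (pow_eq_zero_iff two_ne_zero |>.1 h1)
    rw [Matrix.mul_sub, sub_eq_zero] at h2
    rw [h2, hB₀]
  rw [← hMB, norm_mul_eq_of_balanced h, ← hXB] at hB
  refine le_of_sq_le_sq ?_ (norm_nonneg _)
  have h3 : ‖X‖ ^ 2 ≤ ‖B‖ * ‖V * X‖ := by
    calc ‖X‖ ^ 2 = (B.transpose * (V * X)).trace := by
          rw [frobenius_norm_sq_eq_trace]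
          nth_rw 1 [hXB]
          rw [trace_transpose_mul_mul]
      _ ≤ _ := trace_transpose_mul_le _ _
  rw [mul_pow, Real.sq_sqrt hσ.le]
  nlinarith [norm_nonneg (V * X), norm_nonneg B]

end BalancedFactorization

/-! ### Perturbed factors and the residual error bound -/

section ErrorBound

variable {m n k q : ℕ}

theorem norm_mul_le_add {t δ : ℝ} {U₀ U : Matrix (Fin m) (Fin k) ℝ} {X : Matrix (Fin k) (Fin q) ℝ}
    (h : ‖U₀ * X‖ ≤ t * ‖X‖) (hδ : ‖U - U₀‖ ≤ δ) : ‖U * X‖ ≤ (t + δ) * ‖X‖ := by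
  calc ‖U * X‖ = ‖U₀ * X + (U - U₀) * X‖ := by rw [← Matrix.add_mul, add_sub_cancel]
    _ ≤ ‖U₀ * X‖ + ‖(U - U₀) * X‖ := norm_add_le _ _
    _ ≤ t * ‖X‖ + ‖U - U₀‖ * ‖X‖ := add_le_add h (Matrix.frobenius_norm_mul _ _)
    _ ≤ t * ‖X‖ + δ * ‖X‖ := by gcongr
    _ = _ := by ring

theorem sub_le_norm_mul {s δ : ℝ} {U₀ U : Matrix (Fin m) (Fin k) ℝ} {X : Matrix (Fin k) (Fin q) ℝ}
    (h : s * ‖X‖ ≤ ‖U₀ * X‖) (hδ : ‖U - U₀‖ ≤ δ) : (s - δ) * ‖X‖ ≤ ‖U * X‖ := by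
  have h1 : ‖U₀ * X‖ ≤ ‖U * X‖ + ‖(U - U₀) * X‖ := by
    have := norm_sub_le (U * X) ((U - U₀) * X)
    rwa [← Matrix.sub_mul, sub_sub_cancel] at this
  have h2 : ‖(U - U₀) * X‖ ≤ δ * ‖X‖ := (Matrix.frobenius_norm_mul _ _).trans (by gcongr)
  linarith

/-- A lower bound for `V` on supported matrices passes by duality to `Vᵀ` on the column space of
`V`: with `P Y = V X`, one has `‖P Y‖² = ⟨Vᵀ Y, X⟩`. -/
theorem mul_norm_projection_le {V : Matrix (Fin n) (Fin k) ℝ} {J : Set (Fin k)} {s : ℝ}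
    (hs0 : 0 ≤ s) (hVJ : ∀ j ∉ J, V.col j = 0)
    (hs : ∀ X : Matrix (Fin k) (Fin q) ℝ, (∀ j ∉ J, ∀ i, X j i = 0) → s * ‖X‖ ≤ ‖V * X‖)
    {P : Matrix (Fin n) (Fin n) ℝ} {W : Matrix (Fin k) (Fin n) ℝ} (hPt : P.transpose = P)
    (hPV : P * V = V) (hPW : P = V * W) (Y : Matrix (Fin n) (Fin q) ℝ) :
    s * ‖P * Y‖ ≤ ‖V.transpose * Y‖ := by
  classical
  set d : Fin k → ℝ := fun j => if j ∈ J then 1 else 0 with hd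
  have hVd : V * Matrix.diagonal d = V := by
    ext i j
    rw [Matrix.mul_diagonal]
    by_cases hj : j ∈ J
    · simp [hd, hj]
    · have := congrFun (hVJ j hj) i
      rw [Matrix.col_apply, Pi.zero_apply] at this
      rw [this, zero_mul]
  set X := Matrix.diagonal d * (W * Y) with hX
  have hVX : V * X = P * Y := by
    rw [hX, ← Matrix.mul_assoc, hVd, ← Matrix.mul_assoc, ← hPW]
  have h1 := hs X (fun j hj i => by rw [hX, Matrix.diagonal_mul]; simp [hd, hj])
  have hVP : V.transpose * P = V.transpose := by
    have := congrArg Matrix.transpose hPV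
    rwa [Matrix.transpose_mul, hPt] at this
  clear_value X
  have h2 : ‖P * Y‖ ^ 2 ≤ ‖V.transpose * Y‖ * ‖X‖ := by
    calc ‖P * Y‖ ^ 2 = ((P * Y).transpose * (V * X)).trace := by
          rw [frobenius_norm_sq_eq_trace, hVX]
      _ = ((V.transpose * Y).transpose * X).trace := by
          rw [trace_transpose_mul_mul (P * Y) V X, ← Matrix.mul_assoc, hVP]
      _ ≤ _ := trace_transpose_mul_le _ _
  rw [hVX] at h1
  rcases (norm_nonneg (P * Y)).eq_or_lt with h0 | h0
  · rw [← h0, mul_zero]; exact norm_nonneg _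
  refine le_of_mul_le_mul_right ?_ h0
  calc s * ‖P * Y‖ * ‖P * Y‖ = s * ‖P * Y‖ ^ 2 := by ring
    _ ≤ s * (‖V.transpose * Y‖ * ‖X‖) := by gcongr
    _ = ‖V.transpose * Y‖ * (s * ‖X‖) := by ring
    _ ≤ ‖V.transpose * Y‖ * ‖P * Y‖ := by gcongr

/-- Near a factorization `U₀ V₀ᵀ`, the residual `D = U Vᵀ - U₀ V₀ᵀ` is controlled by `D V` and
`Uᵀ D`. -/
theorem residual_error_bound {U₀ U : Matrix (Fin m) (Fin k) ℝ} {V₀ V : Matrix (Fin n) (Fin k) ℝ}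
    {J : Set (Fin k)} {s δ : ℝ} (hs0 : 0 ≤ s) (hUJ : ∀ j ∉ J, U.col j = 0)
    (hVJ : ∀ j ∉ J, V.col j = 0) (hV₀J : ∀ j ∉ J, V₀.col j = 0)
    (hU₀ : ∀ X : Matrix (Fin k) (Fin n) ℝ, (∀ j ∉ J, ∀ i, X j i = 0) → 4 * δ * ‖X‖ ≤ ‖U₀ * X‖)
    (hU : ∀ X : Matrix (Fin k) (Fin n) ℝ, (∀ j ∉ J, ∀ i, X j i = 0) → s * ‖X‖ ≤ ‖U * X‖)
    (hV : ∀ X : Matrix (Fin k) (Fin m) ℝ, (∀ j ∉ J, ∀ i, X j i = 0) → s * ‖X‖ ≤ ‖V * X‖)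
    (hδ : ‖U - U₀‖ ≤ δ) {D : Matrix (Fin m) (Fin n) ℝ}
    (hD : D = U * V.transpose - U₀ * V₀.transpose) :
    15 / 16 * s ^ 2 * ‖D‖ ^ 2 ≤ ‖D * V‖ ^ 2 + ‖U.transpose * D‖ ^ 2 := by
  obtain ⟨P, W, hPt, hPP, hPU, hPW, -⟩ := exists_column_projection U
  obtain ⟨R, W', hRt, hRR, hRV, hRW, -⟩ := exists_column_projection V
  have hVR : V.transpose * R = V.transpose := by
    have := congrArg Matrix.transpose hRV
    rwa [Matrix.transpose_mul, hRt] at this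
  have h1 : s * ‖R * D.transpose‖ ≤ ‖D * V‖ := by
    have := mul_norm_projection_le hs0 hVJ hV hRt hRV hRW D.transpose
    rwa [← Matrix.transpose_mul, Matrix.frobenius_norm_transpose] at this
  have h2 : s * ‖P * D‖ ≤ ‖U.transpose * D‖ := mul_norm_projection_le hs0 hUJ hU hPt hPU hPW D
  -- `D R` is controlled by `D V`. In the remainder `N` the term `U Vᵀ` disappears, so `N = -U₀ Z`.
  set N := D - D * R with hN
  have hND : ‖D‖ ^ 2 = ‖R * D.transpose‖ ^ 2 + ‖N‖ ^ 2 := by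
    have := frobenius_norm_sq_eq_add_of_projection hRt hRR D.transpose
    rwa [Matrix.frobenius_norm_transpose, ← Matrix.frobenius_norm_transpose (D.transpose - _),
      Matrix.transpose_sub, Matrix.transpose_mul, hRt, Matrix.transpose_transpose] at this
  have hNP : ‖N‖ ^ 2 = ‖P * N‖ ^ 2 + ‖N - P * N‖ ^ 2 :=
    frobenius_norm_sq_eq_add_of_projection hPt hPP N
  have hPN : ‖P * N‖ ≤ ‖P * D‖ := by
    have := frobenius_norm_sub_projection_mul_le hRt hRR (P * D).transpose
    rwa [Matrix.frobenius_norm_transpose, ← Matrix.frobenius_norm_transpose (_ - _),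
      Matrix.transpose_sub, Matrix.transpose_mul R, hRt, Matrix.transpose_transpose,
      Matrix.mul_assoc, ← Matrix.mul_sub] at this
  set Z := V₀.transpose - V₀.transpose * R with hZ
  have hNZ : N = -(U₀ * Z) := by
    rw [hN, hD, hZ, Matrix.sub_mul, Matrix.mul_sub, Matrix.mul_assoc U, hVR, Matrix.mul_assoc U₀]
    abel
  have hZJ : ∀ j ∉ J, ∀ i, Z j i = 0 := by
    intro j hj i
    have h0 : ∀ l, V₀ l j = 0 := fun l => congrFun (hV₀J j hj) l
    simp [hZ, Matrix.mul_apply, h0]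
  clear_value Z
  have hZn : 4 * δ * ‖Z‖ ≤ ‖N‖ := by rw [hNZ, norm_neg]; exact hU₀ Z hZJ
  -- Projecting off the columns of `U` replaces `U₀` by `U₀ - U`, of norm at most `δ`. Against `4 δ
  -- ‖Z‖ ≤ ‖N‖` this loses at most `1/16` of `‖N‖²`, whence the factor `15/16`.
  have hNPN : ‖N - P * N‖ ≤ δ * ‖Z‖ := by
    have h3 : N - P * N = (U - U₀) * Z - P * ((U - U₀) * Z) := by
      rw [hNZ, Matrix.sub_mul, Matrix.mul_sub, ← Matrix.mul_assoc P U, hPU, Matrix.mul_neg]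
      abel
    rw [h3]
    refine (frobenius_norm_sub_projection_mul_le hPt hPP _).trans ?_
    exact (Matrix.frobenius_norm_mul _ _).trans (by gcongr)
  have h4 : ‖N - P * N‖ ^ 2 ≤ (‖N‖ / 4) ^ 2 := by
    gcongr
    linarith
  have h5 : ‖P * N‖ ^ 2 ≤ ‖P * D‖ ^ 2 := by gcongr
  have h6 : 15 / 16 * ‖D‖ ^ 2 ≤ ‖R * D.transpose‖ ^ 2 + ‖P * D‖ ^ 2 := by
    nlinarith [sq_nonneg ‖R * D.transpose‖]
  have h7 : s ^ 2 * ‖R * D.transpose‖ ^ 2 ≤ ‖D * V‖ ^ 2 := by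
    rw [← mul_pow]; gcongr
  have h8 : s ^ 2 * ‖P * D‖ ^ 2 ≤ ‖U.transpose * D‖ ^ 2 := by
    rw [← mul_pow]; gcongr
  nlinarith [sq_nonneg s]

end ErrorBound

/-! ### From the residual to the gradient of the loss -/

section GradientBound

variable {m n p κ k : ℕ} (A : Matrix (Fin m) (Fin n) ℝ →ₗ[ℝ] EuclideanSpace ℝ (Fin p))

/-- `G` is `A* A D`, the gradient of the least-squares loss, obtained by testing on matrix units. -/
theorem exists_trace_eq_inner_map (D : Matrix (Fin m) (Fin n) ℝ) :
    ∃ G : Matrix (Fin m) (Fin n) ℝ, ∀ H, ⟪A D, A H⟫ = (G.transpose * H).trace := by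
  refine ⟨Matrix.of fun i j => ⟪A D, A (Matrix.single i j 1)⟫, fun H => ?_⟩
  rw [map_eq_sum_single A H, trace_transpose_mul_eq_sum]
  simp only [inner_sum, inner_smul_right, Matrix.of_apply]
  exact Finset.sum_congr rfl fun i _ => Finset.sum_congr rfl fun j _ => mul_comm _ _

/-- Restricted isometry is applied to `D` and `D V Vᵀ`. Both have `D` as a left factor, so their
combinations have rank at most `rank D` and the level `k` need not grow. Dividing by `‖D V‖` gives
the bound. -/
theorem le_norm_gradient_mul_right {D G : Matrix (Fin m) (Fin n) ℝ} (hD : D.rank ≤ k)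
    (hG : ∀ H, ⟪A D, A H⟫ = (G.transpose * H).trace) {V : Matrix (Fin n) (Fin κ) ℝ} {t : ℝ}
    (hαβ : restrictedMinEig A k ≤ restrictedMaxEig A k) (ht : 0 ≤ t)
    (hV : ∀ X : Matrix (Fin κ) (Fin m) ℝ, ‖V * X‖ ≤ t * ‖X‖) :
    (restrictedMinEig A k + restrictedMaxEig A k) / 2 * ‖D * V‖
      - (restrictedMaxEig A k - restrictedMinEig A k) / 2 * t * ‖D‖ ≤ ‖G * V‖ := by
  rcases (norm_nonneg (D * V)).eq_or_lt with h0 | h0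
  · rw [← h0]
    have := mul_nonneg (sub_nonneg.2 hαβ) (mul_nonneg ht (norm_nonneg D))
    have := norm_nonneg (G * V)
    linarith
  have h1 := restricted_inner_ge A (X := D) (H := D * V * V.transpose) (k := k) (fun a b => by
    have : a • D + b • (D * V * V.transpose) = D * (a • 1 + b • (V * V.transpose)) := by
      rw [Matrix.mul_add, Matrix.mul_smul, Matrix.mul_smul, Matrix.mul_one, Matrix.mul_assoc]
    rw [this]
    exact (Matrix.rank_mul_le_left _ _).trans hD)
  have h2 : (D.transpose * (D * V * V.transpose)).trace = ‖D * V‖ ^ 2 := by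
    rw [frobenius_norm_sq_eq_trace, Matrix.transpose_mul, ← Matrix.mul_assoc, Matrix.trace_mul_comm,
      Matrix.mul_assoc]
  have h3 : (G.transpose * (D * V * V.transpose)).trace ≤ ‖G * V‖ * ‖D * V‖ := by
    have : (G.transpose * (D * V * V.transpose)).trace = ((G * V).transpose * (D * V)).trace := by
      rw [Matrix.transpose_mul, ← Matrix.mul_assoc, Matrix.trace_mul_comm, Matrix.mul_assoc]
    rw [this]
    exact trace_transpose_mul_le _ _
  have h4 : ‖D * V * V.transpose‖ ≤ t * ‖D * V‖ := by
    have := hV (D * V).transpose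
    rwa [Matrix.frobenius_norm_transpose, ← Matrix.frobenius_norm_transpose (V * _),
      Matrix.transpose_mul, Matrix.transpose_transpose] at this
  rw [h2, hG] at h1
  have h5 : (restrictedMaxEig A k - restrictedMinEig A k) / 2 * (‖D‖ * ‖D * V * V.transpose‖) ≤
      (restrictedMaxEig A k - restrictedMinEig A k) / 2 * (‖D‖ * (t * ‖D * V‖)) := by
    have : 0 ≤ (restrictedMaxEig A k - restrictedMinEig A k) / 2 := by linarith
    gcongr
  refine le_of_mul_le_mul_right ?_ h0
  linarith

theorem le_norm_transpose_mul_gradient {D G : Matrix (Fin m) (Fin n) ℝ} (hD : D.rank ≤ k)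
    (hG : ∀ H, ⟪A D, A H⟫ = (G.transpose * H).trace) {U : Matrix (Fin m) (Fin κ) ℝ} {t : ℝ}
    (hαβ : restrictedMinEig A k ≤ restrictedMaxEig A k) (ht : 0 ≤ t)
    (hU : ∀ X : Matrix (Fin κ) (Fin n) ℝ, ‖U * X‖ ≤ t * ‖X‖) :
    (restrictedMinEig A k + restrictedMaxEig A k) / 2 * ‖U.transpose * D‖
      - (restrictedMaxEig A k - restrictedMinEig A k) / 2 * t * ‖D‖ ≤ ‖U.transpose * G‖ := by
  rcases (norm_nonneg (U.transpose * D)).eq_or_lt with h0 | h0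
  · rw [← h0]
    have := mul_nonneg (sub_nonneg.2 hαβ) (mul_nonneg ht (norm_nonneg D))
    have := norm_nonneg (U.transpose * G)
    linarith
  have h1 := restricted_inner_ge A (X := D) (H := U * (U.transpose * D)) (k := k) (fun a b => by
    have : a • D + b • (U * (U.transpose * D)) = (a • 1 + b • (U * U.transpose)) * D := by
      rw [Matrix.add_mul, Matrix.smul_mul, Matrix.smul_mul, Matrix.one_mul, Matrix.mul_assoc]
    rw [this]
    exact (Matrix.rank_mul_le_right _ _).trans hD)
  have h3 : (G.transpose * (U * (U.transpose * D))).trace ≤ ‖U.transpose * G‖ * ‖U.transpose * D‖ := by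
    rw [trace_transpose_mul_mul]
    exact trace_transpose_mul_le _ _
  have h4 := hU (U.transpose * D)
  rw [trace_transpose_mul_mul D U, ← frobenius_norm_sq_eq_trace, hG] at h1
  have h5 : (restrictedMaxEig A k - restrictedMinEig A k) / 2 * (‖D‖ * ‖U * (U.transpose * D)‖) ≤
      (restrictedMaxEig A k - restrictedMinEig A k) / 2 * (‖D‖ * (t * ‖U.transpose * D‖)) := by
    have : 0 ≤ (restrictedMaxEig A k - restrictedMinEig A k) / 2 := by linarith
    gcongr
  refine le_of_mul_le_mul_right ?_ h0
  linarith

end GradientBound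

/-! ### Numerical constants and gradient dominance -/

section GradientDominance

theorem sqrt_sigma_pow_div_le {σ₁ σr : ℝ} (hr : 0 < σr) (h : σr ≤ σ₁) :
    σr ^ 4 / (128 * √(σ₁ ^ 3) * (4 * σ₁ + σr) ^ 2) ≤ √σr / 3 := by
  have h1 : 0 < σ₁ := hr.trans_le h
  have h2 : √(σr ^ 3) ≤ √(σ₁ ^ 3) := Real.sqrt_le_sqrt (by gcongr)
  have h3 : √(σr ^ 3) = √σr * σr := by
    rw [pow_succ', Real.sqrt_mul hr.le, Real.sqrt_sq hr.le]
  have h4 : 0 < √(σ₁ ^ 3) := by positivity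
  have h5 : √σr * √σr = σr := Real.mul_self_sqrt hr.le
  rw [div_le_iff₀ (by positivity)]
  calc σr ^ 4 = √σr / 3 * (3 * (√σr * σr) * σr ^ 2) := by
        have : √σr / 3 * (3 * (√σr * σr) * σr ^ 2) = √σr * √σr * σr ^ 3 := by ring
        rw [this, h5]; ring
    _ ≤ √σr / 3 * (128 * √(σ₁ ^ 3) * (4 * σ₁ + σr) ^ 2) := by
        rw [← h3]
        have h6 : σr ^ 2 ≤ (4 * σ₁ + σr) ^ 2 := by gcongr; linarith
        gcongr
        norm_num

/-- Since `√σ₁ √(σ₁³) = σ₁²`, clearing denominators turns the ratio hypothesis into positivity of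
the bracket. -/
theorem klBracket_pos_of_ratio_lt {α β σ₁ σr : ℝ} (hα : 0 < α) (hr : 0 < σr) (h : σr ≤ σ₁)
    (hcond : β / α < (128 * σ₁ ^ 2 * (4 * σ₁ + σr) ^ 2 + σr ^ 4) /
      (128 * σ₁ ^ 2 * (4 * σ₁ + σr) ^ 2 - σr ^ 4)) :
    0 < (β + α) * σr ^ 4 / (128 * √(σ₁ ^ 3) * (4 * σ₁ + σr) ^ 2) - √σ₁ * (β - α) := by
  have h1 : 0 < σ₁ := hr.trans_le h
  have hlt : σr ^ 4 < 128 * σ₁ ^ 2 * (4 * σ₁ + σr) ^ 2 := by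
    calc σr ^ 4 = 1 * σr ^ 2 * σr ^ 2 := by ring
      _ < 128 * σ₁ ^ 2 * (4 * σ₁ + σr) ^ 2 := by
        have h6 : σr ^ 2 ≤ (4 * σ₁ + σr) ^ 2 := by gcongr; linarith
        have h7 : σr ^ 2 ≤ σ₁ ^ 2 := by gcongr
        have : 0 < σr ^ 2 := by positivity
        have : (0 : ℝ) < σ₁ ^ 2 := by positivity
        calc 1 * σr ^ 2 * σr ^ 2 ≤ 1 * σ₁ ^ 2 * (4 * σ₁ + σr) ^ 2 := by gcongr
          _ < _ := by gcongr; norm_num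
  rw [div_lt_div_iff₀ hα (by linarith)] at hcond
  have h3 : √(σ₁ ^ 3) = √σ₁ * σ₁ := by
    rw [pow_succ', Real.sqrt_mul h1.le, Real.sqrt_sq h1.le]
  have h4 : 0 < √σ₁ := Real.sqrt_pos.2 h1
  have h5 : √σ₁ * √σ₁ = σ₁ := Real.mul_self_sqrt h1.le
  rw [sub_pos, h3, lt_div_iff₀ (by positivity)]
  have h6 : √σ₁ * (β - α) * (128 * (√σ₁ * σ₁) * (4 * σ₁ + σr) ^ 2) =
      (√σ₁ * √σ₁) * (β - α) * 128 * σ₁ * (4 * σ₁ + σr) ^ 2 := by ring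
  rw [h6, h5]
  nlinarith

/-- The factor `71/100` has square above `1/2`, as the gradient estimate requires. It is also below
`3/4`, which absorbs the crude `√σ_r / 3`, and above `5/8`, which covers the `β - α` terms once
`√σ_r ≤ √σ₁`. -/
theorem mul_klBracket_le {α β σ₁ σr : ℝ} (hα : 0 < α) (hαβ : α ≤ β) (hr : 0 < σr) (h : σr ≤ σ₁) :
    71 / 100 * ((β + α) * σr ^ 4 / (128 * √(σ₁ ^ 3) * (4 * σ₁ + σr) ^ 2) - √σ₁ * (β - α)) ≤
      (α + β) / 2 * (√σr / 2) - (β - α) / 2 * (√σ₁ + √σr / 4) := by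
  have h1 := mul_le_mul_of_nonneg_left (sqrt_sigma_pow_div_le hr h)
    (show 0 ≤ β + α by linarith)
  rw [← mul_div_assoc] at h1
  have h2 : √σr ≤ √σ₁ := Real.sqrt_le_sqrt h
  have h3 := mul_le_mul_of_nonneg_left h2 (show 0 ≤ β - α by linarith)
  have h4 : 0 ≤ (β + α) * √σr := mul_nonneg (by linarith) (Real.sqrt_nonneg _)
  have h5 : 0 ≤ (β - α) * √σ₁ := mul_nonneg (by linarith) (Real.sqrt_nonneg _)
  nlinarith

variable {m n p κ r : ℕ} (A : Matrix (Fin m) (Fin n) ℝ →ₗ[ℝ] EuclideanSpace ℝ (Fin p))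

/-- The cross terms `⟨G V, U B⟩` and `-⟨Gᵀ U, V B⟩` cancel by symmetry of `B`. -/
theorem norm_sq_add_norm_sq_gradient (ν μ : ℝ) (G : Matrix (Fin m) (Fin n) ℝ)
    (U : Matrix (Fin m) (Fin κ) ℝ) (V : Matrix (Fin n) (Fin κ) ℝ)
    {B : Matrix (Fin κ) (Fin κ) ℝ} (hB : B.transpose = B) :
    ‖ν • (G * V) + μ • (U * B)‖ ^ 2 + ‖ν • (G.transpose * U) - μ • (V * B)‖ ^ 2 =
      ν ^ 2 * (‖G * V‖ ^ 2 + ‖U.transpose * G‖ ^ 2) + μ ^ 2 * (‖U * B‖ ^ 2 + ‖V * B‖ ^ 2) := by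
  have h1 : ((G.transpose * U).transpose * (V * B)).trace = ((G * V).transpose * (U * B)).trace := by
    rw [← Matrix.trace_transpose]
    simp only [Matrix.transpose_mul, Matrix.transpose_transpose, hB]
    rw [Matrix.mul_assoc, Matrix.trace_mul_comm]
    simp only [Matrix.mul_assoc]
  have h2 : ‖U.transpose * G‖ = ‖G.transpose * U‖ := by
    rw [← Matrix.frobenius_norm_transpose, Matrix.transpose_mul, Matrix.transpose_transpose]
  rw [sub_eq_add_neg, frobenius_norm_add_sq, frobenius_norm_add_sq, h2, norm_neg]
  simp only [Matrix.transpose_smul, Matrix.smul_mul, Matrix.mul_smul, Matrix.mul_neg,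
    Matrix.trace_neg, Matrix.trace_smul, smul_eq_mul, h1, norm_smul, mul_pow, Real.norm_eq_abs,
    sq_abs]
  ring

set_option maxHeartbeats 1000000 in
/-- Near a balanced factorization of `M`, the squared norm of the gradient of the smooth part of
the factored loss dominates its value. -/
theorem klConstant_mul_le_gradient_sq {ν μ : ℝ} (hν : 0 < ν) (hμ : 0 < μ)
    {U₀ U : Matrix (Fin m) (Fin κ) ℝ} {V₀ V : Matrix (Fin n) (Fin κ) ℝ}
    {M G : Matrix (Fin m) (Fin n) ℝ} {B : Matrix (Fin κ) (Fin κ) ℝ}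
    (hr : 1 ≤ r) (hM : M.rank = r) (hfac : U₀ * V₀.transpose = M)
    (hbal : U₀.transpose * U₀ = V₀.transpose * V₀) (hV₀ : colNorm20 V₀ = r)
    (hUJ : ∀ j, V₀.col j = 0 → U.col j = 0) (hVJ : ∀ j, V₀.col j = 0 → V.col j = 0)
    (hδU : ‖U - U₀‖ ≤ √(sigma M r) / 4) (hδV : ‖V - V₀‖ ≤ √(sigma M r) / 4)
    (hrank : (U * V.transpose - M).rank ≤ 2 * r)
    (hG : ∀ H, ⟪A (U * V.transpose - M), A H⟫ = (G.transpose * H).trace)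
    (hB : B = U.transpose * U - V.transpose * V)
    (hα : 0 < restrictedMinEig A (2 * r))
    (hαβ : restrictedMinEig A (2 * r) ≤ restrictedMaxEig A (2 * r))
    (hb : 0 < (restrictedMaxEig A (2 * r) + restrictedMinEig A (2 * r)) * sigma M r ^ 4 /
      (128 * √(sigma M 1 ^ 3) * (4 * sigma M 1 + sigma M r) ^ 2)
      - √(sigma M 1) * (restrictedMaxEig A (2 * r) - restrictedMinEig A (2 * r))) :
    klConstant ν μ (restrictedMinEig A (2 * r)) (restrictedMaxEig A (2 * r)) (sigma M 1) (sigma M r)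
        * (ν * (1 / 2 * ‖A (U * V.transpose - M)‖ ^ 2) + μ / 4 * ‖B‖ ^ 2) ≤
      ‖ν • (G * V) + μ • (U * B)‖ ^ 2 + ‖ν • (G.transpose * U) - μ • (V * B)‖ ^ 2 := by
  have hσr : 0 < sigma M r := sigma_pos hr hM.ge
  have hσ : sigma M r ≤ sigma M 1 := sigma_le_sigma M hr
  have hV₀up : ∀ {q : ℕ} (X : Matrix (Fin κ) (Fin q) ℝ), ‖V₀ * X‖ ≤ √(sigma M 1) * ‖X‖ :=
    fun X => by have := norm_mul_le_of_balanced hbal X; rwa [hfac] at this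
  have hV₀low : ∀ {q : ℕ} (X : Matrix (Fin κ) (Fin q) ℝ), (∀ j, V₀.col j = 0 → ∀ i, X j i = 0) →
      √(sigma M r) * ‖X‖ ≤ ‖V₀ * X‖ := fun X hX => by
    have := le_norm_mul_of_balanced hbal (hfac ▸ hM) hr hV₀ hX
    rwa [hfac] at this
  have hU₀ : ∀ {q : ℕ} (X : Matrix (Fin κ) (Fin q) ℝ), ‖U₀ * X‖ = ‖V₀ * X‖ := fun X =>
    frobenius_norm_eq_of_gram_eq hbal X
  have hBt : B.transpose = B := by rw [hB]; simp
  have hBJ : ∀ j, V₀.col j = 0 → ∀ i, B j i = 0 := fun j hj i => by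
    have h1 : ∀ l, U l j = 0 := fun l => congrFun (hUJ j hj) l
    have h2 : ∀ l, V l j = 0 := fun l => congrFun (hVJ j hj) l
    simp [hB, Matrix.mul_apply, h1, h2]
  rw [norm_sq_add_norm_sq_gradient ν μ G U V hBt]
  set α := restrictedMinEig A (2 * r) with hαdef
  set β := restrictedMaxEig A (2 * r) with hβdef
  set σ₁ := sigma M 1
  set σr := sigma M r
  set D := U * V.transpose - M with hD
  set e := √σr with he
  have he0 : 0 < e := Real.sqrt_pos.2 hσr
  have hee : e ^ 2 = σr := Real.sq_sqrt hσr.le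
  have hβ : 0 < β := hα.trans_le hαβ
  set b := (β + α) * σr ^ 4 / (128 * √(σ₁ ^ 3) * (4 * σ₁ + σr) ^ 2) - √σ₁ * (β - α) with hbdef
  have hcompl : ∀ j, j ∉ {j | V₀.col j ≠ 0} ↔ V₀.col j = 0 := fun j => by simp
  have herr : 15 / 16 * (e - e / 4) ^ 2 * ‖D‖ ^ 2 ≤ ‖D * V‖ ^ 2 + ‖U.transpose * D‖ ^ 2 := by
    refine residual_error_bound (U₀ := U₀) (V₀ := V₀) (J := {j | V₀.col j ≠ 0}) (δ := e / 4)
      (by linarith) ?_ ?_ ?_ ?_ ?_ ?_ hδU (by rw [hD, hfac])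
    all_goals simp only [hcompl]
    · exact hUJ
    · exact hVJ
    · exact fun j hj => hj
    · intro X hX
      rw [hU₀, mul_div_cancel₀ _ four_ne_zero]
      exact hV₀low X hX
    · exact fun X hX => sub_le_norm_mul ((hV₀low X hX).trans_eq (hU₀ X).symm) hδU
    · exact fun X hX => sub_le_norm_mul (hV₀low X hX) hδV
  have ht : 0 ≤ √σ₁ + e / 4 := by have := Real.sqrt_nonneg σ₁; linarith
  have hGV := le_norm_gradient_mul_right A hrank hG hαβ ht
    (fun X => norm_mul_le_add (hV₀up X) hδV)
  have hGU := le_norm_transpose_mul_gradient A hrank hG hαβ ht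
    (fun X => norm_mul_le_add ((hU₀ X).trans_le (hV₀up X)) hδU)
  have hbr := mul_klBracket_le hα hαβ hσr hσ
  rw [← hbdef, ← he] at hbr
  have hstep : ∀ {x g : ℝ}, e / 2 * ‖D‖ ≤ x →
      (α + β) / 2 * x - (β - α) / 2 * (√σ₁ + e / 4) * ‖D‖ ≤ g → b ^ 2 / 2 * ‖D‖ ^ 2 ≤ g ^ 2 := by
    intro x g hx hg
    have h1 : 71 / 100 * b * ‖D‖ ≤ g := by
      have h2 := mul_le_mul_of_nonneg_right hbr (norm_nonneg D)
      have h3 := mul_le_mul_of_nonneg_left hx (show 0 ≤ (α + β) / 2 by linarith)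
      linarith
    have h2 : (71 / 100 * b * ‖D‖) ^ 2 ≤ g ^ 2 := by gcongr
    have h3 : 0 ≤ b ^ 2 * ‖D‖ ^ 2 := by positivity
    linarith
  have hgrad : b ^ 2 / 2 * ‖D‖ ^ 2 ≤ ‖G * V‖ ^ 2 + ‖U.transpose * G‖ ^ 2 := by
    -- Since `15/16 · (3/4)² > 1/2`, at least one of `‖D V‖` and `‖Uᵀ D‖` reaches `(e/2) ‖D‖`; one
    -- large term suffices.
    by_cases hx : e / 2 * ‖D‖ ≤ ‖D * V‖
    · have := hstep hx hGV
      nlinarith [sq_nonneg ‖U.transpose * G‖]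
    · have hx' : e / 2 * ‖D‖ ≤ ‖U.transpose * D‖ := by
        push Not at hx
        refine le_of_sq_le_sq ?_ (norm_nonneg _)
        have h2 : ‖D * V‖ ^ 2 ≤ (e / 2 * ‖D‖) ^ 2 := by gcongr
        have h3 : 0 ≤ e ^ 2 * ‖D‖ ^ 2 := by positivity
        linarith
      have := hstep hx' hGU
      nlinarith [sq_nonneg ‖G * V‖]
  have hAD : ‖A D‖ ^ 2 ≤ β * ‖D‖ ^ 2 := le_restrictedMaxEig_mul A hrank
  have hpart1 : ν / β * b ^ 2 * (ν * (1 / 2 * ‖A D‖ ^ 2)) ≤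
      ν ^ 2 * (‖G * V‖ ^ 2 + ‖U.transpose * G‖ ^ 2) := by
    calc ν / β * b ^ 2 * (ν * (1 / 2 * ‖A D‖ ^ 2))
        ≤ ν / β * b ^ 2 * (ν * (1 / 2 * (β * ‖D‖ ^ 2))) := by gcongr
      _ = ν ^ 2 * (b ^ 2 / 2 * ‖D‖ ^ 2) := by field_simp
      _ ≤ _ := by gcongr
  have hUB : (e - e / 4) * ‖B‖ ≤ ‖U * B‖ :=
    sub_le_norm_mul ((hV₀low B hBJ).trans_eq (hU₀ B).symm) hδU
  have hVB : (e - e / 4) * ‖B‖ ≤ ‖V * B‖ := sub_le_norm_mul (hV₀low B hBJ) hδV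
  have he34 : 0 ≤ (e - e / 4) * ‖B‖ := mul_nonneg (by linarith) (norm_nonneg _)
  have hUB2 : ((e - e / 4) * ‖B‖) ^ 2 ≤ ‖U * B‖ ^ 2 := by gcongr
  have hVB2 : ((e - e / 4) * ‖B‖) ^ 2 ≤ ‖V * B‖ ^ 2 := by gcongr
  -- The two lower bounds sum to `(9/8) σ_r ‖B‖²`, of which only `(1/2) σ_r ‖B‖²` is needed.
  have hpart2 : 2 * μ * σr * (μ / 4 * ‖B‖ ^ 2) ≤ μ ^ 2 * (‖U * B‖ ^ 2 + ‖V * B‖ ^ 2) := by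
    calc 2 * μ * σr * (μ / 4 * ‖B‖ ^ 2) = μ ^ 2 * (1 / 2 * (e ^ 2 * ‖B‖ ^ 2)) := by
          rw [hee]; ring
      _ ≤ _ := by
          have : 0 ≤ e ^ 2 * ‖B‖ ^ 2 := by positivity
          exact mul_le_mul_of_nonneg_left (by linarith) (sq_nonneg μ)
  have hk1 : klConstant ν μ α β σ₁ σr ≤ ν / β * b ^ 2 := min_le_left _ _
  have hk2 : klConstant ν μ α β σ₁ σr ≤ 2 * μ * σr := min_le_right _ _
  rw [mul_add]
  exact add_le_add ((mul_le_mul_of_nonneg_right hk1 (by positivity)).trans hpart1)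
    ((mul_le_mul_of_nonneg_right hk2 (by positivity)).trans hpart2)

theorem klConstant_pos {ν μ α β σ₁ σr : ℝ} (hν : 0 < ν) (hμ : 0 < μ) (hβ : 0 < β) (hσr : 0 < σr)
    (hb : 0 < (β + α) * σr ^ 4 / (128 * √(σ₁ ^ 3) * (4 * σ₁ + σr) ^ 2) - √σ₁ * (β - α)) :
    0 < klConstant ν μ α β σ₁ σr :=
  lt_min (by positivity) (by positivity)

end GradientDominance

/-! ### Uniqueness of the rank-regularized solution -/

section ExactPenalty

variable {m n p κ r : ℕ} (A : Matrix (Fin m) (Fin n) ℝ →ₗ[ℝ] EuclideanSpace ℝ (Fin p))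

theorem rank_sub_le (X Y : Matrix (Fin m) (Fin n) ℝ) : (X - Y).rank ≤ X.rank + Y.rank := by
  have hle : LinearMap.range (X - Y).mulVecLin ≤
      LinearMap.range X.mulVecLin ⊔ LinearMap.range Y.mulVecLin := by
    rintro _ ⟨v, rfl⟩
    rw [Matrix.mulVecLin_apply, Matrix.sub_mulVec, sub_eq_add_neg, ← Matrix.mulVec_neg]
    exact Submodule.add_mem_sup ⟨v, rfl⟩ ⟨-v, rfl⟩
  exact (Submodule.finrank_mono hle).trans (Submodule.finrank_add_le_finrank_add_finrank _ _)

/-- Each unit of rank saved moves `X` away from `M` by at least `σ_r²` in squared norm, costing at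
least `ν α σ_r² / 2` in the loss. This exceeds the saving, as `ν α σ_r² > 4`. -/
theorem eq_of_leastSquares_add_rank_le {ν : ℝ} (hν : 0 < ν) {M : Matrix (Fin m) (Fin n) ℝ}
    (hr : 1 ≤ r) (hM : M.rank = r) (hα : 4 / (ν * sigma M r ^ 2) < restrictedMinEig A (2 * r))
    {X : Matrix (Fin m) (Fin n) ℝ} (hX : ν * leastSquares A (A M) X + X.rank ≤ r) : X = M := by
  have hσr : 0 < sigma M r := sigma_pos hr hM.ge
  have hf : leastSquares A (A M) X = 1 / 2 * ‖A (X - M)‖ ^ 2 := by rw [leastSquares, map_sub]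
  rw [hf] at hX
  have hf0 : 0 ≤ ν * (1 / 2 * ‖A (X - M)‖ ^ 2) := by positivity
  have hrk : (X.rank : ℝ) ≤ r := by linarith
  have hrk' : X.rank ≤ r := by exact_mod_cast hrk
  have h1 := restrictedMinEig_mul_le A (k := 2 * r) (X := X - M)
    ((rank_sub_le X M).trans (by omega))
  have h2 := rank_sub_rank_mul_sigma_sq_le hM X
  rw [div_lt_iff₀ (by positivity)] at hα
  set α := restrictedMinEig A (2 * r)
  by_contra hne
  have h3 : 0 < ‖X - M‖ ^ 2 := pow_pos (norm_pos_iff.2 (sub_ne_zero.2 hne)) 2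
  have h4 : ν * (1 / 2 * (α * ‖X - M‖ ^ 2)) ≤ r - X.rank := by
    have : ν * (1 / 2 * (α * ‖X - M‖ ^ 2)) ≤ ν * (1 / 2 * ‖A (X - M)‖ ^ 2) := by gcongr
    linarith
  have h5 := mul_le_mul_of_nonneg_right h4 (sq_nonneg (sigma M r))
  have h6 := mul_lt_mul_of_pos_right hα h3
  linarith

end ExactPenalty

/-! ### Subgradients along smooth directions -/

section Subdifferential

variable {E : Type*} [NormedAddCommGroup E] [InnerProductSpace ℝ E]

/-- Along a direction in which `g` agrees with a differentiable function up to a constant,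
a regular subgradient acts as the directional derivative. -/
theorem inner_eq_of_mem_regularSubdifferential {g h : E → ℝ} {x v d : E} {c : ℝ}
    (hv : v ∈ regularSubdifferential g x)
    (hh : HasDerivAt (fun t : ℝ => h (x + t • d)) c 0)
    (hgh : ∀ᶠ t : ℝ in 𝓝 0, g (x + t • d) - g x = h (x + t • d) - h x) : ⟪v, d⟫ = c := by
  have hcont : Tendsto (fun t : ℝ => x + t • d) (𝓝 0) (𝓝 x) := by
    have : Continuous fun t : ℝ => x + t • d := by fun_prop
    simpa using this.tendsto 0
  have key : ∀ ε > 0, |c - ⟪v, d⟫| ≤ ε * (‖d‖ + 1) := by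
    intro ε hε
    have h1 := hcont.eventually (hv ε hε)
    have h2 := (hasDerivAt_iff_isLittleO.1 hh).def hε
    have h3 := (h1.and (hgh.and h2))
    obtain ⟨δ, hδ, hball⟩ := Metric.eventually_nhds_iff.1 h3
    have hx : ∀ t : ℝ, |t| < δ → -(ε * (|t| * ‖d‖) + ε * |t|) ≤ t * (c - ⟪v, d⟫) := by
      intro t ht
      obtain ⟨ha, hb, hc⟩ := hball (y := t) (by simpa using ht)
      simp only [zero_smul, add_zero, sub_zero, Real.norm_eq_abs, smul_eq_mul] at hc
      rw [add_sub_cancel_left, hb, norm_smul, inner_smul_right, Real.norm_eq_abs] at ha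
      have := (abs_le.1 hc).2
      linarith
    -- Testing both signs of `t` turns the one-sided subgradient inequality into an equality.
    have hp := hx (δ / 2) (by rw [abs_of_pos (by linarith)]; linarith)
    have hm := hx (-(δ / 2)) (by rw [abs_neg, abs_of_pos (by linarith)]; linarith)
    rw [abs_neg] at hm
    rw [abs_of_pos (by linarith)] at hp hm
    rw [abs_le]
    constructor
    · refine le_of_mul_le_mul_left ?_ (half_pos hδ)
      linarith
    · refine le_of_mul_le_mul_left ?_ (half_pos hδ)
      linarith
  have h0 : |c - ⟪v, d⟫| ≤ 0 := by
    refine le_of_forall_pos_le_add fun ε hε => ?_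
    have := key (ε / (‖d‖ + 1)) (by positivity)
    rwa [div_mul_cancel₀ _ (by positivity), ← zero_add ε] at this
  have := abs_nonpos_iff.1 h0
  linarith

theorem zero_mem_regularSubdifferential_of_isMinOn {g : E → ℝ} {x : E} (h : IsMinOn g univ x) :
    (0 : E) ∈ regularSubdifferential g x := by
  intro ε hε
  refine Eventually.of_forall fun y => ?_
  have h1 : g x ≤ g y := h (mem_univ y)
  have h2 : 0 ≤ ε * ‖y - x‖ := by positivity
  rw [inner_zero_left]
  linarith

theorem regularSubdifferential_subset_limitingSubdifferential (g : E → ℝ) (x : E) :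
    regularSubdifferential g x ⊆ limitingSubdifferential g x := fun v hv =>
  ⟨fun _ => x, fun _ => v, tendsto_const_nhds, tendsto_const_nhds, fun _ => hv, tendsto_const_nhds⟩

end Subdifferential

/-! ### Pairs of factors as a Euclidean space -/

namespace FactorSpace

variable {m n κ : ℕ}

/-- The pair `(U, V)` as a point of the factor space. -/
def ofMatrices (U : Matrix (Fin m) (Fin κ) ℝ) (V : Matrix (Fin n) (Fin κ) ℝ) :
    FactorSpace m n κ :=
  WithLp.toLp 2 (Sum.elim (fun p => U p.1 p.2) fun p => V p.1 p.2)

@[simp] theorem left_ofMatrices (U : Matrix (Fin m) (Fin κ) ℝ) (V : Matrix (Fin n) (Fin κ) ℝ) :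
    (ofMatrices U V).left = U := rfl

@[simp] theorem right_ofMatrices (U : Matrix (Fin m) (Fin κ) ℝ) (V : Matrix (Fin n) (Fin κ) ℝ) :
    (ofMatrices U V).right = V := rfl

theorem left_add_smul (z d : FactorSpace m n κ) (t : ℝ) :
    (z + t • d).left = z.left + t • d.left := rfl

theorem right_add_smul (z d : FactorSpace m n κ) (t : ℝ) :
    (z + t • d).right = z.right + t • d.right := rfl

theorem inner_eq_trace_add_trace (z w : FactorSpace m n κ) :
    ⟪z, w⟫ = (z.left.transpose * w.left).trace + (z.right.transpose * w.right).trace := by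
  rw [PiLp.inner_apply, Fintype.sum_sum_type, trace_transpose_mul_eq_sum,
    trace_transpose_mul_eq_sum, ← Fintype.sum_prod_type', ← Fintype.sum_prod_type']
  simp [left, right, mul_comm]

theorem norm_sq_eq_add (z : FactorSpace m n κ) : ‖z‖ ^ 2 = ‖z.left‖ ^ 2 + ‖z.right‖ ^ 2 := by
  rw [← real_inner_self_eq_norm_sq, inner_eq_trace_add_trace, frobenius_norm_sq_eq_trace,
    frobenius_norm_sq_eq_trace]

theorem norm_left_sub_left_le_dist (z w : FactorSpace m n κ) : ‖z.left - w.left‖ ≤ dist z w := by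
  rw [dist_eq_norm]
  refine le_of_sq_le_sq ?_ (norm_nonneg _)
  rw [norm_sq_eq_add]
  exact le_add_of_nonneg_right (sq_nonneg _)

theorem norm_right_sub_right_le_dist (z w : FactorSpace m n κ) :
    ‖z.right - w.right‖ ≤ dist z w := by
  rw [dist_eq_norm]
  refine le_of_sq_le_sq ?_ (norm_nonneg _)
  rw [norm_sq_eq_add]
  exact le_add_of_nonneg_left (sq_nonneg _)

theorem eventually_left_col_ne_zero (z : FactorSpace m n κ) :
    ∀ᶠ x : FactorSpace m n κ in 𝓝 z, ∀ j, z.left.col j ≠ 0 → x.left.col j ≠ 0 := by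
  rw [eventually_all]
  intro j
  by_cases hj : z.left.col j = 0
  · exact Eventually.of_forall fun x h => absurd hj h
  obtain ⟨i, hi⟩ := Function.ne_iff.1 hj
  have hc : Continuous fun x : FactorSpace m n κ => x (Sum.inl (i, j)) := by fun_prop
  filter_upwards [hc.continuousAt.eventually_ne hi] with x hx _ h0
  exact hx (congrFun h0 i)

theorem eventually_right_col_ne_zero (z : FactorSpace m n κ) :
    ∀ᶠ x : FactorSpace m n κ in 𝓝 z, ∀ j, z.right.col j ≠ 0 → x.right.col j ≠ 0 := by
  rw [eventually_all]
  intro j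
  by_cases hj : z.right.col j = 0
  · exact Eventually.of_forall fun x h => absurd hj h
  obtain ⟨i, hi⟩ := Function.ne_iff.1 hj
  have hc : Continuous fun x : FactorSpace m n κ => x (Sum.inr (i, j)) := by fun_prop
  filter_upwards [hc.continuousAt.eventually_ne hi] with x hx _ h0
  exact hx (congrFun h0 i)

end FactorSpace

/-! ### The smooth part of the factored loss and its gradient -/

section SmoothPart

variable {m n p κ : ℕ} (A : Matrix (Fin m) (Fin n) ℝ →ₗ[ℝ] EuclideanSpace ℝ (Fin p))

/-- The smooth part of the factored loss. -/
noncomputable def smoothFactoredLoss (ν μ : ℝ) (b : EuclideanSpace ℝ (Fin p)) (z : FactorSpace m n κ) : ℝ :=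
  ν * leastSquares A b (z.left * z.right.transpose)
    + μ / 4 * ‖z.left.transpose * z.left - z.right.transpose * z.right‖ ^ 2

/-- The directional derivative of the smooth part of the factored loss. -/
noncomputable def smoothFactoredLossDeriv (ν μ : ℝ) (b : EuclideanSpace ℝ (Fin p)) (z d : FactorSpace m n κ) :
    ℝ :=
  ν * ⟪A (z.left * z.right.transpose) - b,
      A (d.left * z.right.transpose + z.left * d.right.transpose)⟫
    + μ / 2 * ((z.left.transpose * z.left - z.right.transpose * z.right).transpose *
      (d.left.transpose * z.left + z.left.transpose * d.left
        - (d.right.transpose * z.right + z.right.transpose * d.right))).trace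

theorem factoredLoss_eq_smooth_add (ν μ : ℝ) (b : EuclideanSpace ℝ (Fin p))
    (z : FactorSpace m n κ) :
    factoredLoss ν μ (leastSquares A b) z = smoothFactoredLoss A ν μ b z
      + 1 / 2 * ((colNorm20 z.left : ℝ) + (colNorm20 z.right : ℝ)) := rfl

/-- Along a line in factor space the residual is quadratic in `t`; only its linear coefficient
enters the derivative at `0`. -/
theorem hasDerivAt_norm_sq_quadratic {q : ℕ} (X Y Z : EuclideanSpace ℝ (Fin q)) :
    HasDerivAt (fun t : ℝ => ‖X + t • Y + t ^ 2 • Z‖ ^ 2) (2 * ⟪X, Y⟫) 0 := by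
  have h : HasDerivAt (fun t : ℝ => X + t • Y + t ^ 2 • Z) Y 0 := by
    have h1 := ((hasDerivAt_id (0 : ℝ)).smul_const Y).const_add X
    have h2 := ((hasDerivAt_id (0 : ℝ)).fun_pow 2).smul_const Z
    have h3 := h1.fun_add h2
    simpa using h3
  simpa using h.norm_sq

theorem hasDerivAt_frobenius_norm_sq_quadratic {q : ℕ} (X Y Z : Matrix (Fin q) (Fin q) ℝ) :
    HasDerivAt (fun t : ℝ => ‖X + t • Y + t ^ 2 • Z‖ ^ 2) (2 * (X.transpose * Y).trace) 0 := by
  simp only [frobenius_norm_sq_eq_sum, trace_transpose_mul_eq_sum, Finset.mul_sum]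
  refine HasDerivAt.fun_sum fun i _ => HasDerivAt.fun_sum fun j _ => ?_
  simp only [Matrix.add_apply, Matrix.smul_apply, smul_eq_mul]
  have h1 := ((hasDerivAt_id (0 : ℝ)).mul_const (Y i j)).const_add (X i j)
  have h2 := ((hasDerivAt_id (0 : ℝ)).fun_pow 2).mul_const (Z i j)
  have h3 := (h1.fun_add h2).fun_pow 2
  simpa [mul_assoc] using h3

theorem hasDerivAt_smoothFactoredLoss (ν μ : ℝ) (b : EuclideanSpace ℝ (Fin p))
    (z d : FactorSpace m n κ) :
    HasDerivAt (fun t : ℝ => smoothFactoredLoss A ν μ b (z + t • d))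
      (smoothFactoredLossDeriv A ν μ b z d) 0 := by
  have h1 := hasDerivAt_norm_sq_quadratic (A (z.left * z.right.transpose) - b)
    (A (d.left * z.right.transpose + z.left * d.right.transpose)) (A (d.left * d.right.transpose))
  have h2 := hasDerivAt_frobenius_norm_sq_quadratic
    (z.left.transpose * z.left - z.right.transpose * z.right)
    (d.left.transpose * z.left + z.left.transpose * d.left
        - (d.right.transpose * z.right + z.right.transpose * d.right))
    (d.left.transpose * d.left - d.right.transpose * d.right)
  have h3 := ((h1.const_mul (1 / 2)).const_mul ν).add (h2.const_mul (μ / 4))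
  refine (h3.congr_deriv ?_).congr_of_eventuallyEq (Eventually.of_forall fun t => ?_)
  · rw [smoothFactoredLossDeriv]; ring
  · have e1 : (z.left + t • d.left) * (z.right + t • d.right).transpose =
        z.left * z.right.transpose + t • (d.left * z.right.transpose + z.left * d.right.transpose)
          + t ^ 2 • (d.left * d.right.transpose) := by
      simp only [Matrix.transpose_add, Matrix.transpose_smul, Matrix.add_mul, Matrix.mul_add,
        Matrix.smul_mul, Matrix.mul_smul, smul_add, smul_smul, sq]
      abel
    have e2 : (z.left + t • d.left).transpose * (z.left + t • d.left)
        - (z.right + t • d.right).transpose * (z.right + t • d.right) =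
        (z.left.transpose * z.left - z.right.transpose * z.right) +
        t • (d.left.transpose * z.left + z.left.transpose * d.left
        - (d.right.transpose * z.right + z.right.transpose * d.right)) +
        t ^ 2 • (d.left.transpose * d.left - d.right.transpose * d.right) := by
      simp only [Matrix.transpose_add, Matrix.transpose_smul, Matrix.add_mul, Matrix.mul_add,
        Matrix.smul_mul, Matrix.mul_smul, smul_add, smul_sub, smul_smul, sq]
      abel
    simp only [smoothFactoredLoss, FactorSpace.left_add_smul, FactorSpace.right_add_smul, e1, e2,
      leastSquares, map_add A, map_smul A, Pi.add_apply]
    congr 5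
    abel

theorem continuous_map_of_continuous_entries {X : Type*} [TopologicalSpace X]
    {F : X → Matrix (Fin m) (Fin n) ℝ} (hF : ∀ i j, Continuous fun x => F x i j) :
    Continuous fun x => A (F x) := by
  rw [show (fun x => A (F x)) = _ from funext fun x => map_eq_sum_single A (F x)]
  exact continuous_finsetSum _ fun i _ => continuous_finsetSum _ fun j _ =>
    (hF i j).smul continuous_const

theorem continuous_smoothFactoredLossDeriv (ν μ : ℝ) (b : EuclideanSpace ℝ (Fin p))
    (d : FactorSpace m n κ) : Continuous fun z => smoothFactoredLossDeriv A ν μ b z d := by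
  unfold smoothFactoredLossDeriv
  have h1 : Continuous fun z : FactorSpace m n κ => A (z.left * z.right.transpose) :=
    continuous_map_of_continuous_entries A fun i j => by
      simp only [Matrix.mul_apply, Matrix.transpose_apply, FactorSpace.left, FactorSpace.right,
        Matrix.of_apply]
      fun_prop
  have h2 : Continuous fun z : FactorSpace m n κ =>
      A (d.left * z.right.transpose + z.left * d.right.transpose) :=
    continuous_map_of_continuous_entries A fun i j => by
      simp only [Matrix.mul_apply, Matrix.transpose_apply, FactorSpace.left, FactorSpace.right,
        Matrix.of_apply, Matrix.add_apply]
      fun_prop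
  refine (continuous_const.mul ((h1.sub continuous_const).inner h2)).add (continuous_const.mul ?_)
  simp only [trace_transpose_mul_eq_sum, Matrix.mul_apply, Matrix.transpose_apply, FactorSpace.left,
    FactorSpace.right, Matrix.of_apply, Matrix.add_apply, Matrix.sub_apply]
  fun_prop

/-- Along directions supported on the nonzero columns of `z`, limiting subgradients of the factored
loss at `z` act as the derivative of its smooth part. -/
theorem inner_eq_of_mem_limitingSubdifferential {ν μ : ℝ} {b : EuclideanSpace ℝ (Fin p)}
    {z d v : FactorSpace m n κ}
    (hv : v ∈ limitingSubdifferential (factoredLoss ν μ (leastSquares A b)) z)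
    (hl : ∀ j, z.left.col j = 0 → d.left.col j = 0)
    (hr : ∀ j, z.right.col j = 0 → d.right.col j = 0) :
    ⟪v, d⟫ = smoothFactoredLossDeriv A ν μ b z d := by
  obtain ⟨xs, vs, hxs, -, hvs, hlim⟩ := hv
  have h1 : Tendsto (fun k => ⟪vs k, d⟫) atTop (𝓝 ⟪v, d⟫) := hlim.inner tendsto_const_nhds
  have h2 : Tendsto (fun k => smoothFactoredLossDeriv A ν μ b (xs k) d) atTop
      (𝓝 (smoothFactoredLossDeriv A ν μ b z d)) :=
    ((continuous_smoothFactoredLossDeriv A ν μ b d).tendsto z).comp hxs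
  refine tendsto_nhds_unique h1 (h2.congr' ?_)
  -- Columns nonzero at `z` stay nonzero at `xs k`, so `d` is still supported on nonzero columns
  -- there. Small moves along `d` leave both counts unchanged, even if `xs k` has more nonzero
  -- columns than `z`.
  filter_upwards [hxs.eventually z.eventually_left_col_ne_zero,
    hxs.eventually z.eventually_right_col_ne_zero] with k hkl hkr
  set x := xs k
  refine (inner_eq_of_mem_regularSubdifferential (hvs k)
    (hasDerivAt_smoothFactoredLoss A ν μ b x d) ?_).symm
  have hcont : Tendsto (fun t : ℝ => x + t • d) (𝓝 0) (𝓝 x) := by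
    have : Continuous fun t : ℝ => x + t • d := by fun_prop
    simpa using this.tendsto 0
  filter_upwards [hcont.eventually x.eventually_left_col_ne_zero,
    hcont.eventually x.eventually_right_col_ne_zero] with t htl htr
  have e1 : colNorm20 (x + t • d).left = colNorm20 x.left := by
    rw [colNorm20, colNorm20]
    congr 1
    ext j
    refine ⟨fun h h0 => h ?_, htl j⟩
    have hd := hl j (by by_contra hne; exact hkl j hne h0)
    ext i
    have a1 := congrFun h0 i
    have a2 := congrFun hd i
    simp only [Matrix.col_apply, Pi.zero_apply] at a1 a2
    simp [FactorSpace.left_add_smul, a1, a2]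
  have e2 : colNorm20 (x + t • d).right = colNorm20 x.right := by
    rw [colNorm20, colNorm20]
    congr 1
    ext j
    refine ⟨fun h h0 => h ?_, htr j⟩
    have hd := hr j (by by_contra hne; exact hkr j hne h0)
    ext i
    have a1 := congrFun h0 i
    have a2 := congrFun hd i
    simp only [Matrix.col_apply, Pi.zero_apply] at a1 a2
    simp [FactorSpace.right_add_smul, a1, a2]
  rw [factoredLoss_eq_smooth_add, factoredLoss_eq_smooth_add, e1, e2]
  ring

theorem smoothFactoredLossDeriv_eq_inner {ν μ : ℝ} {M G : Matrix (Fin m) (Fin n) ℝ}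
    {z : FactorSpace m n κ}
    (hG : ∀ H, ⟪A (z.left * z.right.transpose - M), A H⟫ = (G.transpose * H).trace)
    (d : FactorSpace m n κ) {B : Matrix (Fin κ) (Fin κ) ℝ}
    (hB : B = z.left.transpose * z.left - z.right.transpose * z.right) :
    smoothFactoredLossDeriv A ν μ (A M) z d =
      ⟪FactorSpace.ofMatrices (ν • (G * z.right) + μ • (z.left * B))
        (ν • (G.transpose * z.left) - μ • (z.right * B)), d⟫ := by
  have hBt : B.transpose = B := by rw [hB]; simp
  rw [smoothFactoredLossDeriv, ← map_sub, hG, ← hB, FactorSpace.inner_eq_trace_add_trace, hBt]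
  simp only [FactorSpace.left_ofMatrices, FactorSpace.right_ofMatrices, Matrix.transpose_add,
    Matrix.transpose_sub, Matrix.transpose_smul, Matrix.transpose_mul, hBt,
    Matrix.transpose_transpose, Matrix.add_mul, Matrix.sub_mul, Matrix.mul_add, Matrix.mul_sub,
    Matrix.trace_add, Matrix.trace_sub, Matrix.smul_mul, Matrix.trace_smul, smul_eq_mul]
  have t1 : (G.transpose * (d.left * z.right.transpose)).trace =
      (z.right.transpose * G.transpose * d.left).trace := by
    rw [← Matrix.mul_assoc, Matrix.trace_mul_comm, Matrix.mul_assoc]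
  have t2 : (G.transpose * (z.left * d.right.transpose)).trace =
      (z.left.transpose * G * d.right).trace := by
    rw [← Matrix.trace_transpose]
    simp only [Matrix.transpose_mul, Matrix.transpose_transpose]
    rw [Matrix.mul_assoc, Matrix.trace_mul_comm, Matrix.mul_assoc]
  have t3 : ∀ {l : ℕ} (X Y : Matrix (Fin l) (Fin κ) ℝ),
      (B * (X.transpose * Y)).trace = (B * (Y.transpose * X)).trace := by
    intro l X Y
    rw [← Matrix.trace_transpose]
    simp only [Matrix.transpose_mul, Matrix.transpose_transpose, hBt]
    rw [Matrix.trace_mul_comm]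
  rw [t1, t2, t3 d.left, t3 d.right, Matrix.mul_assoc B, Matrix.mul_assoc B]
  ring

end SmoothPart

/-! ### Minimizers of the factored loss and the local estimate -/

section FactoredSolutions

variable {m n p κ r : ℕ} (A : Matrix (Fin m) (Fin n) ℝ →ₗ[ℝ] EuclideanSpace ℝ (Fin p))

theorem leastSquares_nonneg (b : EuclideanSpace ℝ (Fin p)) (X : Matrix (Fin m) (Fin n) ℝ) :
    0 ≤ leastSquares A b X := by
  unfold leastSquares; positivity

/-- The rank of `M` is admissible for the factorization if some solution has rank at most `κ`. -/
theorem rank_le_of_rankRegSolutions_inter_nonempty {ν : ℝ} (hν : 0 < ν)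
    {M : Matrix (Fin m) (Fin n) ℝ} (hr : 1 ≤ r) (hM : M.rank = r)
    (hα : 4 / (ν * sigma M r ^ 2) < restrictedMinEig A (2 * r))
    (hX : (rankRegSolutions ν (leastSquares A (A M)) ∩ rankLE m n κ).Nonempty) : r ≤ κ := by
  obtain ⟨X, hXmin, hXκ⟩ := hX
  have h1 : ν * leastSquares A (A M) X + X.rank ≤ ν * leastSquares A (A M) M + M.rank :=
    hXmin (mem_univ M)
  have h2 : leastSquares A (A M) M = 0 := by simp [leastSquares]
  rw [h2, mul_zero, zero_add, hM] at h1
  rw [eq_of_leastSquares_add_rank_le A hν hr hM hα h1] at hXκ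
  exact hM ▸ hXκ

/-- Global minimizers of the factored loss are balanced factorizations of `M` with exactly `r`
nonzero columns. -/
theorem factoredSolutions_spec {ν μ : ℝ} (hν : 0 < ν) (hμ : 0 < μ)
    {M : Matrix (Fin m) (Fin n) ℝ} (hr : 1 ≤ r) (hM : M.rank = r) (hrκ : r ≤ κ)
    (hα : 4 / (ν * sigma M r ^ 2) < restrictedMinEig A (2 * r)) {z : FactorSpace m n κ}
    (hz : z ∈ factoredSolutions κ ν μ (leastSquares A (A M))) :
    z.left * z.right.transpose = M ∧
      z.left.transpose * z.left = z.right.transpose * z.right ∧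
      colNorm20 z.left = r ∧ colNorm20 z.right = r ∧
      factoredLoss ν μ (leastSquares A (A M)) z = r := by
  obtain ⟨U, V, hUV, hbal, hU, hV⟩ := exists_balanced_factorization hM hrκ
  have hU' : (colNorm20 U : ℝ) ≤ r := by exact_mod_cast hU
  have hV' : (colNorm20 V : ℝ) ≤ r := by exact_mod_cast hV
  have hle : factoredLoss ν μ (leastSquares A (A M)) z ≤ r := by
    have h1 : factoredLoss ν μ (leastSquares A (A M)) z ≤
        factoredLoss ν μ (leastSquares A (A M)) (FactorSpace.ofMatrices U V) := hz (mem_univ _)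
    refine h1.trans ?_
    simp only [factoredLoss, FactorSpace.left_ofMatrices, FactorSpace.right_ofMatrices, hUV, hbal,
      leastSquares, sub_self, norm_zero]
    linarith
  have hf0 := mul_nonneg hν.le (leastSquares_nonneg A (A M) (z.left * z.right.transpose))
  have hB0 : 0 ≤ μ / 4 *
      ‖z.left.transpose * z.left - z.right.transpose * z.right‖ ^ 2 := by positivity
  have hrl : (z.left * z.right.transpose).rank ≤ colNorm20 z.left :=
    (Matrix.rank_mul_le_left _ _).trans (rank_le_colNorm20 _)
  have hrr : (z.left * z.right.transpose).rank ≤ colNorm20 z.right := by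
    refine (Matrix.rank_mul_le_right _ _).trans ?_
    rw [Matrix.rank_transpose]
    exact rank_le_colNorm20 _
  have hrl' : ((z.left * z.right.transpose).rank : ℝ) ≤ colNorm20 z.left := by exact_mod_cast hrl
  have hrr' : ((z.left * z.right.transpose).rank : ℝ) ≤ colNorm20 z.right := by exact_mod_cast hrr
  rw [factoredLoss] at hle ⊢
  have hfac : z.left * z.right.transpose = M :=
    eq_of_leastSquares_add_rank_le A hν hr hM hα (by linarith)
  rw [hfac, hM] at hrl hrr hrl' hrr'
  rw [hfac] at hf0
  rw [hfac] at hle ⊢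
  have hl : (colNorm20 z.left : ℝ) = r := by linarith
  have hrt : (colNorm20 z.right : ℝ) = r := by linarith
  have hB : ‖z.left.transpose * z.left - z.right.transpose * z.right‖ ^ 2 = 0 := by
    have : μ / 4 * ‖z.left.transpose * z.left - z.right.transpose * z.right‖ ^ 2 ≤ 0 := by linarith
    nlinarith [sq_nonneg ‖z.left.transpose * z.left - z.right.transpose * z.right‖]
  refine ⟨rfl, sub_eq_zero.1 (norm_eq_zero.1 (pow_eq_zero_iff two_ne_zero |>.1 hB)),
    by exact_mod_cast hl, by exact_mod_cast hrt, ?_⟩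
  rw [hB, hl, hrt, leastSquares, sub_self, norm_zero]
  ring

/-- Tested on the `j`-th coordinate vector, the lower bound `s - δ > 0` survives the perturbation.
-/
theorem col_ne_zero_of_le_norm_mul {l : ℕ} {s δ : ℝ} {U₀ U : Matrix (Fin l) (Fin κ) ℝ}
    {J : Set (Fin κ)} (hδ : ‖U - U₀‖ ≤ δ) (hsδ : δ < s)
    (hU₀ : ∀ X : Matrix (Fin κ) (Fin 1) ℝ, (∀ j ∉ J, ∀ i, X j i = 0) → s * ‖X‖ ≤ ‖U₀ * X‖)
    {j : Fin κ} (hj : j ∈ J) : U.col j ≠ 0 := by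
  intro h0
  set X : Matrix (Fin κ) (Fin 1) ℝ := Matrix.single j 0 1 with hX
  have h1 := sub_le_norm_mul (hU₀ X fun i hi c => by
    rw [hX, Matrix.single_apply_of_row_ne (by rintro rfl; exact hi hj)]) hδ
  have h2 : U * X = 0 := by
    ext a c
    have := congrFun h0 a
    simp only [Matrix.col_apply, Pi.zero_apply] at this
    rw [Matrix.mul_apply, Finset.sum_eq_single j]
    · simp [this]
    · intro i _ hi
      rw [hX, Matrix.single_apply_of_row_ne (Ne.symm hi), mul_zero]
    · simp
  rw [h2, norm_zero] at h1
  have h3 : X = 0 := norm_le_zero_iff.1 (by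
    by_contra! hlt
    nlinarith)
  have h4 : X j 0 = 1 := by simp [hX]
  rw [h3] at h4
  simp at h4

theorem norm_le_of_inner_eq_norm_sq {E : Type*} [NormedAddCommGroup E] [InnerProductSpace ℝ E]
    {v d : E} (h : ⟪v, d⟫ = ‖d‖ ^ 2) : ‖d‖ ≤ ‖v‖ := by
  have h1 := real_inner_le_norm v d
  rw [h] at h1
  by_contra! hlt
  nlinarith [norm_nonneg v]

/-- Near a global minimizer and at slightly larger values, the squared distance from `0` to the
subdifferential dominates the gap in the factored loss. -/
theorem klConstant_mul_gap_le_infEDist_sq {ν μ : ℝ} (hν : 0 < ν) (hμ : 0 < μ)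
    {M : Matrix (Fin m) (Fin n) ℝ} (hr : 1 ≤ r) (hM : M.rank = r) (hrκ : r ≤ κ)
    (hα : 4 / (ν * sigma M r ^ 2) < restrictedMinEig A (2 * r))
    (hα0 : 0 < restrictedMinEig A (2 * r))
    (hαβ : restrictedMinEig A (2 * r) ≤ restrictedMaxEig A (2 * r))
    (hb : 0 < (restrictedMaxEig A (2 * r) + restrictedMinEig A (2 * r)) * sigma M r ^ 4 /
      (128 * √(sigma M 1 ^ 3) * (4 * sigma M 1 + sigma M r) ^ 2)
      - √(sigma M 1) * (restrictedMaxEig A (2 * r) - restrictedMinEig A (2 * r)))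
    {zbar z : FactorSpace m n κ}
    (hzbar : zbar ∈ factoredSolutions κ ν μ (leastSquares A (A M)))
    (hdist : dist z zbar < √(sigma M r) / 4)
    (hgap : factoredLoss ν μ (leastSquares A (A M)) z
      - factoredLoss ν μ (leastSquares A (A M)) zbar < 1 / 2) :
    ENNReal.ofReal (klConstant ν μ (restrictedMinEig A (2 * r)) (restrictedMaxEig A (2 * r))
      (sigma M 1) (sigma M r) * (factoredLoss ν μ (leastSquares A (A M)) z
        - factoredLoss ν μ (leastSquares A (A M)) zbar)) ≤
      Metric.infEDist 0
        (limitingSubdifferential (factoredLoss ν μ (leastSquares A (A M))) z) ^ 2 := by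
  obtain ⟨hfac, hbal, hl, hrt, hval⟩ := factoredSolutions_spec A hν hμ hr hM hrκ hα hzbar
  have hσr : 0 < sigma M r := sigma_pos hr hM.ge
  have he : 0 < √(sigma M r) := Real.sqrt_pos.2 hσr
  have hδU := (FactorSpace.norm_left_sub_left_le_dist z zbar).trans hdist.le
  have hδV := (FactorSpace.norm_right_sub_right_le_dist z zbar).trans hdist.le
  set J : Set (Fin κ) := {j | zbar.right.col j ≠ 0} with hJ
  have hJc : J.ncard = r := hrt
  have hlowV : ∀ X : Matrix (Fin κ) (Fin 1) ℝ, (∀ j ∉ J, ∀ i, X j i = 0) →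
      √(sigma M r) * ‖X‖ ≤ ‖zbar.right * X‖ := fun X hX => by
    have := le_norm_mul_of_balanced hbal (hfac ▸ hM) hr hrt (X := X)
      (fun j hj => hX j (by simpa [hJ] using hj))
    rwa [hfac] at this
  have hlowU : ∀ X : Matrix (Fin κ) (Fin 1) ℝ, (∀ j ∉ J, ∀ i, X j i = 0) →
      √(sigma M r) * ‖X‖ ≤ ‖zbar.left * X‖ := fun X hX => by
    rw [frobenius_norm_eq_of_gram_eq hbal]
    exact hlowV X hX
  have hJU : J ⊆ {j | z.left.col j ≠ 0} := fun j hj =>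
    col_ne_zero_of_le_norm_mul hδU (by linarith) hlowU hj
  have hJV : J ⊆ {j | z.right.col j ≠ 0} := fun j hj =>
    col_ne_zero_of_le_norm_mul hδV (by linarith) hlowV hj
  have hcl : r ≤ colNorm20 z.left := hJc ▸ ncard_le_ncard hJU (toFinite _)
  have hcr : r ≤ colNorm20 z.right := hJc ▸ ncard_le_ncard hJV (toFinite _)
  set B := z.left.transpose * z.left - z.right.transpose * z.right with hB
  have hloss : factoredLoss ν μ (leastSquares A (A M)) z =
      (ν * (1 / 2 * ‖A (z.left * z.right.transpose - M)‖ ^ 2) + μ / 4 * ‖B‖ ^ 2)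
        + 1 / 2 * ((colNorm20 z.left : ℝ) + (colNorm20 z.right : ℝ)) := by
    rw [factoredLoss, leastSquares, map_sub]
  have hsum : colNorm20 z.left + colNorm20 z.right ≤ 2 * r := by
    have h0 : 0 ≤ ν * (1 / 2 * ‖A (z.left * z.right.transpose - M)‖ ^ 2) + μ / 4 * ‖B‖ ^ 2 := by
      positivity
    -- A single extra nonzero column in either factor would already cost `1/2`.
    have h1 : (colNorm20 z.left : ℝ) + colNorm20 z.right < 2 * r + 1 := by
      rw [hloss, hval] at hgap
      linarith
    have h2 : colNorm20 z.left + colNorm20 z.right < 2 * r + 1 := by exact_mod_cast h1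
    omega
  have hcl' : colNorm20 z.left = r := by omega
  have hcr' : colNorm20 z.right = r := by omega
  have hUJ : J = {j | z.left.col j ≠ 0} :=
    eq_of_subset_of_ncard_le hJU (by rw [hJc]; exact hcl'.le) (toFinite _)
  have hVJ : J = {j | z.right.col j ≠ 0} :=
    eq_of_subset_of_ncard_le hJV (by rw [hJc]; exact hcr'.le) (toFinite _)
  have hUJ' : ∀ j, zbar.right.col j = 0 ↔ z.left.col j = 0 := fun j => by
    have := Set.ext_iff.1 hUJ j
    exact not_iff_not.1 this
  have hVJ' : ∀ j, zbar.right.col j = 0 ↔ z.right.col j = 0 := fun j => by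
    have := Set.ext_iff.1 hVJ j
    exact not_iff_not.1 this
  obtain ⟨G, hG⟩ := exists_trace_eq_inner_map A (z.left * z.right.transpose - M)
  have hrank : (z.left * z.right.transpose - M).rank ≤ 2 * r := by
    have h1 := (Matrix.rank_mul_le_left z.left z.right.transpose).trans (rank_le_colNorm20 _)
    have h2 := rank_sub_le (z.left * z.right.transpose) M
    omega
  have hmain := klConstant_mul_le_gradient_sq A hν hμ hr hM hfac hbal hrt
    (fun j => (hUJ' j).1) (fun j => (hVJ' j).1) hδU hδV hrank hG hB hα0 hαβ hb
  set d : FactorSpace m n κ := FactorSpace.ofMatrices (ν • (G * z.right) + μ • (z.left * B))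
    (ν • (G.transpose * z.left) - μ • (z.right * B)) with hd
  have hcol : ∀ j, zbar.right.col j = 0 → d.left.col j = 0 ∧ d.right.col j = 0 := by
    intro j hj
    have h1 : ∀ i, z.left i j = 0 := fun i => congrFun ((hUJ' j).1 hj) i
    have h2 : ∀ i, z.right i j = 0 := fun i => congrFun ((hVJ' j).1 hj) i
    have h3 : ∀ i, B i j = 0 := fun i => by simp [hB, Matrix.mul_apply, h1, h2]
    constructor
    · ext i
      simp [hd, Matrix.mul_apply, h2, h3]
    · ext i
      simp [hd, Matrix.mul_apply, h1, h3]
  have hgapeq : factoredLoss ν μ (leastSquares A (A M)) z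
      - factoredLoss ν μ (leastSquares A (A M)) zbar =
      ν * (1 / 2 * ‖A (z.left * z.right.transpose - M)‖ ^ 2) + μ / 4 * ‖B‖ ^ 2 := by
    rw [hloss, hval, hcl', hcr']
    ring
  have hdn : ‖d‖ ^ 2 = ‖ν • (G * z.right) + μ • (z.left * B)‖ ^ 2
      + ‖ν • (G.transpose * z.left) - μ • (z.right * B)‖ ^ 2 := FactorSpace.norm_sq_eq_add d
  rw [hgapeq]
  refine (ENNReal.ofReal_le_ofReal (hmain.trans_eq hdn.symm)).trans ?_
  rw [ENNReal.ofReal_pow (norm_nonneg _)]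
  gcongr
  rw [Metric.le_infEDist]
  -- The smooth gradient `d` lies in the frozen support, so `⟪v, d⟫ = ‖d‖²` for every limiting
  -- subgradient `v`.
  intro v hv
  have hvd : ⟪v, d⟫ = ‖d‖ ^ 2 := by
    rw [inner_eq_of_mem_limitingSubdifferential A hv (fun j hj => (hcol j ((hUJ' j).2 hj)).1)
      (fun j hj => (hcol j ((hVJ' j).2 hj)).2), smoothFactoredLossDeriv_eq_inner A hG d hB, ← hd,
      real_inner_self_eq_norm_sq]
  rw [edist_dist, dist_zero_left]
  exact ENNReal.ofReal_le_ofReal (norm_le_of_inner_eq_norm_sq hvd)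

end FactoredSolutions

/-! ### The Kurdyka-Łojasiewicz property -/

section KurdykaLojasiewicz

variable {E : Type*} [NormedAddCommGroup E] [InnerProductSpace ℝ E]

/-- A quadratic growth estimate for the distance to the subdifferential near a global minimizer
gives the Kurdyka-Łojasiewicz property of exponent `1/2`. -/
theorem hasKLPropertyHalf_of_le_infEDist_sq {g : E → ℝ} {x₀ : E} (hmin : IsMinOn g univ x₀)
    {γ δ η : ℝ} (hγ : 0 < γ) (hδ : 0 < δ) (hη : 0 < η)
    (h : ∀ x, dist x x₀ < δ → 0 < g x - g x₀ → g x - g x₀ < η →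
      ENNReal.ofReal (γ * (g x - g x₀)) ≤ Metric.infEDist 0 (limitingSubdifferential g x) ^ 2) :
    HasKLPropertyHalf g x₀ := by
  have hγ' : 0 < √γ := Real.sqrt_pos.2 hγ
  -- The constant `2 / √γ` is chosen so that `φ' s` times `√γ √s`, the lower bound on the distance,
  -- equals one.
  have hderiv : ∀ s : ℝ, 0 < s → deriv (fun s => 2 / √γ * √s) s = 1 / (√γ * √s) := by
    intro s hs
    have := ((Real.hasDerivAt_sqrt hs.ne').const_mul (2 / √γ)).deriv
    rw [this]
    have := Real.sqrt_pos.2 hs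
    field_simp
  refine ⟨2 / √γ, by positivity, ⟨0, regularSubdifferential_subset_limitingSubdifferential g x₀
    (zero_mem_regularSubdifferential_of_isMinOn hmin)⟩, (η : EReal), by exact_mod_cast hη, ?_, ?_,
    ?_, ?_, ?_, ?_, Metric.ball x₀ δ, Metric.ball_mem_nhds _ hδ, ?_⟩
  · fun_prop
  · have hset : {s : ℝ | 0 ≤ s ∧ (s : EReal) < η} = Ico 0 η := by
      ext s; simp
    rw [hset]
    have h1 : ConcaveOn ℝ (Ico 0 η) Real.sqrt :=
      Real.strictConcaveOn_sqrt.concaveOn.subset (fun s hs => hs.1) (convex_Ico 0 η)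
    exact h1.smul (c := 2 / √γ) (by positivity)
  · intro s _ _; positivity
  · simp
  · intro s hs
    exact (contDiffAt_const.mul (Real.contDiffAt_sqrt hs.1.ne')).contDiffWithinAt
  · intro s hs _
    rw [hderiv s hs]
    have := Real.sqrt_pos.2 hs
    positivity
  · intro x hx hgx hgη
    set s := g x - g x₀ with hs
    have hs0 : 0 < s := sub_pos.2 hgx
    have hsη : s < η := by exact_mod_cast hgη
    have hss := Real.sqrt_pos.2 hs0
    have h1 := h x hx hs0 hsη
    have h2 : ENNReal.ofReal (√γ * √s) ≤ Metric.infEDist 0 (limitingSubdifferential g x) := by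
      rw [← ENNReal.pow_le_pow_left_iff two_ne_zero, ← ENNReal.ofReal_pow (by positivity), mul_pow,
        Real.sq_sqrt hγ.le, Real.sq_sqrt hs0.le]
      exact h1
    rw [hderiv s hs0]
    calc (1 : ℝ≥0∞) = ENNReal.ofReal (1 / (√γ * √s)) * ENNReal.ofReal (√γ * √s) := by
          rw [← ENNReal.ofReal_mul (by positivity), one_div_mul_cancel (by positivity),
            ENNReal.ofReal_one]
      _ ≤ _ := by gcongr

end KurdykaLojasiewicz

theorem mainTheorem1 (m n p κ r : ℕ) (hr : 1 ≤ r) (ν μ : ℝ) (hν : 0 < ν) (hμ : 0 < μ)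
    (A : Matrix (Fin m) (Fin n) ℝ →ₗ[ℝ] EuclideanSpace ℝ (Fin p))
    (M : Matrix (Fin m) (Fin n) ℝ) (hM : M.rank = r)
    (f : Matrix (Fin m) (Fin n) ℝ → ℝ) (hf : f = leastSquares A (A M))
    (α β σ₁ σr : ℝ)
    (hα : α = restrictedMinEig A (2 * r)) (hβ : β = restrictedMaxEig A (2 * r))
    (hσ₁ : σ₁ = sigma M 1) (hσr : σr = sigma M r)
    (hX : (rankRegSolutions ν f ∩ rankLE m n κ).Nonempty)
    (hcond : β / α <
      (128 * σ₁ ^ 2 * (4 * σ₁ + σr) ^ 2 + σr ^ 4) / (128 * σ₁ ^ 2 * (4 * σ₁ + σr) ^ 2 - σr ^ 4))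
    (hαlow : 4 / (ν * σr ^ 2) < α)
    (zbar : FactorSpace m n κ) (hzbar : zbar ∈ factoredSolutions κ ν μ f) :
    (∀ z : FactorSpace m n κ, dist z zbar < √σr / 4 →
      0 < factoredLoss ν μ f z - factoredLoss ν μ f zbar →
      factoredLoss ν μ f z - factoredLoss ν μ f zbar < 1 / 2 →
      ENNReal.ofReal (klConstant ν μ α β σ₁ σr *
          (factoredLoss ν μ f z - factoredLoss ν μ f zbar)) ≤
        Metric.infEDist 0 (limitingSubdifferential (factoredLoss ν μ f) z) ^ 2) ∧
    HasKLPropertyHalf (factoredLoss ν μ f) zbar := by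

  subst hf hα hβ hσ₁ hσr
  have hσr : 0 < sigma M r := sigma_pos hr hM.ge
  have hσ : sigma M r ≤ sigma M 1 := sigma_le_sigma M hr
  have hα0 : 0 < restrictedMinEig A (2 * r) := lt_trans (by positivity) hαlow
  have hM0 : 0 < ‖M‖ ^ 2 := by
    have : M ≠ 0 := by
      rintro rfl
      rw [Matrix.rank_zero] at hM
      omega
    exact pow_pos (norm_pos_iff.2 this) 2
  -- `M` itself is a nonzero matrix of rank at most `2 r` on which both eigenvalue bounds can be
  -- tested.
  have hαβ : restrictedMinEig A (2 * r) ≤ restrictedMaxEig A (2 * r) :=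
    le_of_mul_le_mul_right ((restrictedMinEig_mul_le A (k := 2 * r) (X := M) (by omega)).trans
      (le_restrictedMaxEig_mul A (by omega))) hM0
  have hb := klBracket_pos_of_ratio_lt hα0 hσr hσ hcond
  have hrκ := rank_le_of_rankRegSolutions_inter_nonempty A hν hr hM hαlow hX
  have hgap := fun (z : FactorSpace m n κ) hd hg =>
    klConstant_mul_gap_le_infEDist_sq A hν hμ hr hM hrκ hαlow hα0 hαβ hb (z := z) hzbar hd hg
  exact ⟨fun z hd _ hg => hgap z hd hg, hasKLPropertyHalf_of_le_infEDist_sq hzbar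
    (klConstant_pos hν hμ (hα0.trans_le hαβ) hσr hb) (by positivity) one_half_pos
    fun z hd _ hg => hgap z hd hg⟩
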